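/- Let $K$ be a field, let $A=K\langle x_1,\dots,x_n\rangle$ be the free associative unital $K$-algebra of rank $n\ge 2$, and let $I$ be a maximal two-sided ideal of $A$ such that $A/I$ is isomorphic, as a $K$-algebra, to the matrix ring $M_m(D)$, where $D$ is a division algebra over $K$ of finite dimension $\dim_K D=l$. Then: (1) The set $\mathfrak F$ of all right ideals of $A$ that contain some power $I^k$ $(k\in\mathbb N)$ is a (right) Gabriel topology on $A$, the $I$-adic topology. (2) $\mathfrak F$ is perfect: if $Q=A_{\mathfrak F}=\varinjlim_{J\in\mathfrak F}\operatorname{Hom}_A(J,A/t(A))$, where $t(A)=\{a\in A: aJ=0\text{ for some }J\in\mathfrak F\}$, is the ring of right quotients of $A$ with respect to $\mathfrak F$, and $\varphi:A\to Q$ is the canonical homomorphism, then $\varphi$ is an epimorphism of rings, $Q$ is a flat left $A$-module via $\varphi$, and a right ideal $J$ of $A$ belongs to $\mathfrak F$ if and only if $\varphi(J)Q=Q$. (3) The module type of $Q$ is $(1,\,lm(n-1)+1)$. That is, $Q\ne 0$, and $q=lm(n-1)+1$ is the smallest integer $q>1$ for which the right $Q$-modules $Q$ and $Q^{q}$ are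 isomorphic. (In general, a nonzero ring $R$ has module type $(p,q)$ if $p\ge 1$ is the smallest integer such that the right $R$-modules $R^p$ and $R^{j}$ are isomorphic for some $j>p$, and $q$ is the smallest integer $>p$ such that $R^p\cong R^q$.) -/

import Mathlib

open scoped TensorProduct

universe u

/-- A right ideal of `A` is a submodule of `A` regarded as a right module over itself. -/
abbrev RightIdeal (A : Type u) [Ring A] : Type u := Submodule Aᵐᵒᵖ A

namespace RightIdeal

variable {A : Type u} [Ring A]

/-- `(J : a) = {x | a * x ∈ J}`. -/
def colon (J : RightIdeal A) (a : A) : RightIdeal A where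
  carrier := {x | a * x ∈ J}
  add_mem' := by
    intro x y hx hy
    simpa [mul_add] using J.add_mem hx hy
  zero_mem' := by simp
  smul_mem' := by
    intro c x hx
    have h := J.smul_mem c hx
    simpa [mul_assoc] using h

@[simp] theorem mem_colon {J : RightIdeal A} {a x : A} : x ∈ J.colon a ↔ a * x ∈ J := Iff.rfl

theorem mul_mem_right {J : RightIdeal A} {x : A} (hx : x ∈ J) (a : A) : x * a ∈ J := by
  simpa using J.smul_mem (MulOpposite.op a) hx

/-- The preimage of a right ideal under a ring homomorphism. -/
def comap {B : Type u} [Ring B] (φ : A →+* B) (J : RightIdeal B) : RightIdeal A where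
  carrier := {x | φ x ∈ J}
  add_mem' := by
    intro x y hx hy
    simpa using J.add_mem hx hy
  zero_mem' := by simp
  smul_mem' := by
    intro c x hx
    simpa using mul_mem_right hx (φ c.unop)

@[simp] theorem mem_comap {B : Type u} [Ring B] {φ : A →+* B} {J : RightIdeal B} {x : A} :
    x ∈ J.comap φ ↔ φ x ∈ J := Iff.rfl

end RightIdeal

/-- A (right) Gabriel topology on the ring `A`, given by its set of open right ideals: a filter of
right ideals that is closed under `J ↦ (J : a)`, and such that `J` is open as soon as `(J : b)` is
open for all `b` in some open right ideal `L`. -/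
structure GabrielTopology (A : Type u) [Ring A] where
  opens : Set (RightIdeal A)
  top_mem : ⊤ ∈ opens
  mem_of_le : ∀ {J L : RightIdeal A}, J ∈ opens → J ≤ L → L ∈ opens
  inf_mem : ∀ {J L : RightIdeal A}, J ∈ opens → L ∈ opens → J ⊓ L ∈ opens
  colon_mem : ∀ {J : RightIdeal A}, J ∈ opens → ∀ a : A, J.colon a ∈ opens
  mem_of_colon_mem : ∀ {J L : RightIdeal A}, L ∈ opens → (∀ b ∈ L, J.colon b ∈ opens) → J ∈ opens

namespace GabrielTopology

variable {A : Type u} [Ring A] (F : GabrielTopology A)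

/-! ### Germs of partially defined endomorphisms of the right module `A` -/

/-- A homomorphism of right `A`-modules `dom → A` on an open right ideal `dom`. -/
structure PartialHom where
  dom : RightIdeal A
  dom_mem : dom ∈ F.opens
  hom : dom →ₗ[Aᵐᵒᵖ] A

namespace PartialHom

variable {F}

/-- Two partial homomorphisms have the same germ if they agree on an open right ideal on which both
are defined. -/
def Eqv (f g : PartialHom F) : Prop :=
  ∃ J ∈ F.opens, ∃ (hf : J ≤ f.dom) (hg : J ≤ g.dom),
    ∀ (x : A) (hx : x ∈ J), f.hom ⟨x, hf hx⟩ = g.hom ⟨x, hg hx⟩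

variable (F) in
instance setoid : Setoid (PartialHom F) where
  r := Eqv
  iseqv := by
    refine ⟨fun f => ⟨f.dom, f.dom_mem, le_rfl, le_rfl, fun _ _ => rfl⟩, ?_, ?_⟩
    · rintro f g ⟨J, hJ, hf, hg, h⟩
      exact ⟨J, hJ, hg, hf, fun x hx => (h x hx).symm⟩
    · rintro f g k ⟨J, hJ, hf, hg, h⟩ ⟨L, hL, hg', hk, h'⟩
      exact ⟨J ⊓ L, F.inf_mem hJ hL, inf_le_left.trans hf, inf_le_right.trans hk,
        fun x hx => (h x hx.1).trans (h' x hx.2)⟩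

/-- Left multiplication by `a`, defined on all of `A`. -/
def lmul (a : A) : PartialHom F where
  dom := ⊤
  dom_mem := F.top_mem
  hom :=
    { toFun := fun x => a * x.1
      map_add' := by intro x y; simp [mul_add]
      map_smul' := by intro c x; simp [mul_assoc] }

/-- The sum, defined on the intersection of the domains. -/
def add (f g : PartialHom F) : PartialHom F where
  dom := f.dom ⊓ g.dom
  dom_mem := F.inf_mem f.dom_mem g.dom_mem
  hom := f.hom ∘ₗ Submodule.inclusion inf_le_left + g.hom ∘ₗ Submodule.inclusion inf_le_right

/-- The negative of a partial homomorphism. -/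
def neg (f : PartialHom F) : PartialHom F where
  dom := f.dom
  dom_mem := f.dom_mem
  hom := -f.hom

/-- The domain `{x ∈ dom g | g x ∈ dom f}` of the composition `f ∘ g`. -/
def compDom (f g : PartialHom F) : RightIdeal A where
  carrier := {x | ∃ hx : x ∈ g.dom, g.hom ⟨x, hx⟩ ∈ f.dom}
  add_mem' := by
    rintro x y ⟨hx, hx'⟩ ⟨hy, hy'⟩
    refine ⟨g.dom.add_mem hx hy, ?_⟩
    have h := f.dom.add_mem hx' hy'
    rwa [← map_add] at h
  zero_mem' := ⟨g.dom.zero_mem, by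
    have h : (⟨0, g.dom.zero_mem⟩ : g.dom) = 0 := rfl
    rw [h, map_zero]
    exact f.dom.zero_mem⟩
  smul_mem' := by
    rintro c x ⟨hx, hx'⟩
    refine ⟨g.dom.smul_mem c hx, ?_⟩
    have h := f.dom.smul_mem c hx'
    rwa [← map_smul] at h

theorem compDom_mem (f g : PartialHom F) : compDom f g ∈ F.opens := by
  refine F.mem_of_colon_mem g.dom_mem fun b hb => ?_
  refine F.mem_of_le (F.colon_mem f.dom_mem (g.hom ⟨b, hb⟩)) fun x hx => ?_
  refine ⟨RightIdeal.mul_mem_right hb x, ?_⟩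
  have h : g.hom (MulOpposite.op x • ⟨b, hb⟩) = g.hom ⟨b, hb⟩ * x := by
    rw [map_smul]; rfl
  have hx' : g.hom ⟨b, hb⟩ * x ∈ f.dom := hx
  rw [← h] at hx'
  exact hx'

/-- The composition `f ∘ g`, defined on `{x ∈ dom g | g x ∈ dom f}`. -/
def comp (f g : PartialHom F) : PartialHom F where
  dom := compDom f g
  dom_mem := compDom_mem f g
  hom :=
    { toFun := fun x => f.hom ⟨g.hom ⟨x.1, x.2.1⟩, x.2.2⟩
      map_add' := by
        rintro ⟨x, hx, hx'⟩ ⟨y, hy, hy'⟩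
        rw [← map_add]
        congr 1
        apply Subtype.ext
        change g.hom (⟨x, hx⟩ + ⟨y, hy⟩) = g.hom ⟨x, hx⟩ + g.hom ⟨y, hy⟩
        exact map_add _ _ _
      map_smul' := by
        rintro c ⟨x, hx, hx'⟩
        rw [RingHom.id_apply, ← map_smul]
        congr 1
        apply Subtype.ext
        change g.hom (c • ⟨x, hx⟩) = c • g.hom ⟨x, hx⟩
        exact map_smul _ _ _ }

theorem add_eqv {f f' g g' : PartialHom F} (hf : f ≈ f') (hg : g ≈ g') : add f g ≈ add f' g' := by
  obtain ⟨J, hJ, h1, h2, h⟩ := hf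
  obtain ⟨L, hL, k1, k2, k⟩ := hg
  refine ⟨J ⊓ L, F.inf_mem hJ hL, inf_le_inf h1 k1, inf_le_inf h2 k2, fun x hx => ?_⟩
  exact congrArg₂ (· + ·) (h x hx.1) (k x hx.2)

theorem neg_eqv {f f' : PartialHom F} (hf : f ≈ f') : neg f ≈ neg f' := by
  obtain ⟨J, hJ, h1, h2, h⟩ := hf
  exact ⟨J, hJ, h1, h2, fun x hx => congrArg Neg.neg (h x hx)⟩

theorem comp_eqv {f f' g g' : PartialHom F} (hf : f ≈ f') (hg : g ≈ g') :
    comp f g ≈ comp f' g' := by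
  obtain ⟨J, hJ, h1, h2, h⟩ := hf
  obtain ⟨L, hL, k1, k2, k⟩ := hg
  let f₀ : PartialHom F := ⟨J, hJ, f.hom ∘ₗ Submodule.inclusion h1⟩
  let g₀ : PartialHom F := ⟨L, hL, g.hom ∘ₗ Submodule.inclusion k1⟩
  have e : ∀ (x : A) (hx : x ∈ L), g₀.hom ⟨x, hx⟩ = g'.hom ⟨x, k2 hx⟩ := k
  refine ⟨compDom f₀ g₀, compDom_mem f₀ g₀, ?_, ?_, ?_⟩
  · rintro x ⟨hx, hx'⟩
    exact ⟨k1 hx, h1 hx'⟩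
  · rintro x ⟨hx, hx'⟩
    refine ⟨k2 hx, ?_⟩
    rw [← e x hx]
    exact h2 hx'
  · rintro x ⟨hx, hx'⟩
    refine (h _ hx').trans ?_
    change f'.hom _ = f'.hom _
    congr 1
    exact Subtype.ext (e x hx)

end PartialHom

/-- The direct limit of the groups `Hom_A(J, A)` of homomorphisms of right `A`-modules, where `J`
runs through the open right ideals, ordered by reverse inclusion. -/
def Germs : Type u := Quotient (PartialHom.setoid F)

namespace Germs

variable {F}

/-- The germ of a partial homomorphism. -/
def mk (f : PartialHom F) : Germs F := Quotient.mk _ f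

theorem mk_eq_mk {f g : PartialHom F} : mk f = mk g ↔ PartialHom.Eqv f g := Quotient.eq

instance : Zero (Germs F) := ⟨mk (PartialHom.lmul 0)⟩
instance : One (Germs F) := ⟨mk (PartialHom.lmul 1)⟩
instance : Add (Germs F) := ⟨Quotient.map₂ PartialHom.add
  (fun _ _ hf _ _ hg => PartialHom.add_eqv hf hg)⟩
instance : Neg (Germs F) := ⟨Quotient.map PartialHom.neg (fun _ _ hf => PartialHom.neg_eqv hf)⟩
instance : Mul (Germs F) := ⟨Quotient.map₂ PartialHom.comp
  (fun _ _ hf _ _ hg => PartialHom.comp_eqv hf hg)⟩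

theorem zero_def : (0 : Germs F) = mk (PartialHom.lmul 0) := rfl
theorem one_def : (1 : Germs F) = mk (PartialHom.lmul 1) := rfl
theorem mk_add (f g : PartialHom F) : mk f + mk g = mk (PartialHom.add f g) := rfl
theorem mk_neg (f : PartialHom F) : -mk f = mk (PartialHom.neg f) := rfl
theorem mk_mul (f g : PartialHom F) : mk f * mk g = mk (PartialHom.comp f g) := rfl

theorem ind {p : Germs F → Prop} (h : ∀ f, p (mk f)) (q : Germs F) : p q := Quotient.ind h q

/-- Addition of germs is addition of values, multiplication of germs is composition. -/
instance : Ring (Germs F) where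
  add_assoc := by
    refine ind fun f => ind fun g => ind fun k => ?_
    refine mk_eq_mk.2 ⟨f.dom ⊓ g.dom ⊓ k.dom,
      F.inf_mem (F.inf_mem f.dom_mem g.dom_mem) k.dom_mem, le_rfl,
      fun x hx => ⟨hx.1.1, hx.1.2, hx.2⟩, fun x hx => add_assoc _ _ _⟩
  zero_add := by
    refine ind fun f => mk_eq_mk.2 ⟨f.dom, f.dom_mem, fun x hx => ⟨trivial, hx⟩, le_rfl,
      fun x hx => ?_⟩
    change 0 * x + f.hom ⟨x, hx⟩ = _
    rw [zero_mul, zero_add]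
  add_zero := by
    refine ind fun f => mk_eq_mk.2 ⟨f.dom, f.dom_mem, fun x hx => ⟨hx, trivial⟩, le_rfl,
      fun x hx => ?_⟩
    change f.hom ⟨x, hx⟩ + 0 * x = _
    rw [zero_mul, add_zero]
  add_comm := by
    refine ind fun f => ind fun g => ?_
    exact mk_eq_mk.2 ⟨f.dom ⊓ g.dom, F.inf_mem f.dom_mem g.dom_mem, le_rfl,
      fun x hx => ⟨hx.2, hx.1⟩, fun x hx => add_comm _ _⟩
  neg_add_cancel := by
    refine ind fun f => ?_
    refine mk_eq_mk.2 ⟨f.dom, f.dom_mem, fun x hx => ⟨hx, hx⟩, fun x hx => trivial,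
      fun x hx => ?_⟩
    change -f.hom ⟨x, hx⟩ + f.hom ⟨x, hx⟩ = 0 * x
    rw [zero_mul, neg_add_cancel]
  nsmul := nsmulRec
  zsmul := zsmulRec
  mul_assoc := by
    refine ind fun f => ind fun g => ind fun k => ?_
    refine mk_eq_mk.2 ⟨_, PartialHom.compDom_mem (PartialHom.comp f g) k, le_rfl, ?_, ?_⟩
    · rintro x ⟨hx, hx', hx''⟩
      exact ⟨⟨hx, hx'⟩, hx''⟩
    · rintro x ⟨hx, hx', hx''⟩
      rfl
  one_mul := by
    refine ind fun f => mk_eq_mk.2 ⟨f.dom, f.dom_mem, fun x hx => ⟨hx, trivial⟩, le_rfl,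
      fun x hx => ?_⟩
    change 1 * f.hom ⟨x, hx⟩ = _
    rw [one_mul]
  mul_one := by
    refine ind fun f => mk_eq_mk.2 ⟨f.dom, f.dom_mem, fun x hx => ⟨trivial, ?_⟩, le_rfl,
      fun x hx => ?_⟩
    · change 1 * x ∈ f.dom
      rwa [one_mul]
    · change f.hom ⟨1 * x, _⟩ = _
      congr 1
      exact Subtype.ext (one_mul x)
  zero_mul := by
    refine ind fun f => mk_eq_mk.2 ⟨f.dom, f.dom_mem, fun x hx => ⟨hx, trivial⟩,
      fun x hx => trivial, fun x hx => ?_⟩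
    change 0 * f.hom ⟨x, hx⟩ = 0 * x
    rw [zero_mul, zero_mul]
  mul_zero := by
    refine ind fun f => mk_eq_mk.2 ⟨⊤, F.top_mem, fun x hx => ⟨trivial, ?_⟩,
      fun x hx => trivial, fun x hx => ?_⟩
    · change 0 * x ∈ f.dom
      rw [zero_mul]
      exact f.dom.zero_mem
    · have h : ∀ h' : 0 * x ∈ f.dom, f.hom ⟨0 * x, h'⟩ = 0 * x := by
        intro h'
        have e : (⟨0 * x, h'⟩ : f.dom) = 0 := Subtype.ext (zero_mul x)
        rw [e, map_zero, zero_mul]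
      exact h _
  left_distrib := by
    refine ind fun f => ind fun g => ind fun k => ?_
    refine mk_eq_mk.2 ⟨_, F.inf_mem (PartialHom.compDom_mem f g) (PartialHom.compDom_mem f k),
      ?_, le_rfl, ?_⟩
    · rintro x ⟨⟨hx, hx'⟩, hy, hy'⟩
      exact ⟨⟨hx, hy⟩, f.dom.add_mem hx' hy'⟩
    · rintro x ⟨⟨hx, hx'⟩, hy, hy'⟩
      exact map_add f.hom ⟨_, hx'⟩ ⟨_, hy'⟩
  right_distrib := by
    refine ind fun f => ind fun g => ind fun k => ?_
    refine mk_eq_mk.2 ⟨_, F.inf_mem (PartialHom.compDom_mem f k) (PartialHom.compDom_mem g k),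
      ?_, le_rfl, ?_⟩
    · rintro x ⟨⟨hx, hx'⟩, hy, hy'⟩
      exact ⟨hx, hx', hy'⟩
    · rintro x ⟨⟨hx, hx'⟩, hy, hy'⟩
      rfl

variable (F) in
/-- The ring homomorphism that sends `a` to the germ of the left multiplication by `a`. -/
def of : A →+* Germs F where
  toFun a := mk (PartialHom.lmul a)
  map_one' := rfl
  map_zero' := rfl
  map_add' a b := mk_eq_mk.2 ⟨⊤, F.top_mem, fun _ _ => trivial, fun _ _ => ⟨trivial, trivial⟩,
    fun x _ => add_mul a b x⟩
  map_mul' a b := mk_eq_mk.2 ⟨⊤, F.top_mem, fun _ _ => trivial, fun _ _ => ⟨trivial, trivial⟩,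
    fun x _ => mul_assoc a b x⟩

end Germs

/-! ### The ring of right quotients -/

/-- The torsion ideal `t(A) = {a | a J = 0 for some open right ideal J}`. -/
def torsion : Ideal A where
  carrier := {a | ∃ J ∈ F.opens, ∀ x ∈ J, a * x = 0}
  add_mem' := by
    rintro a b ⟨J, hJ, ha⟩ ⟨L, hL, hb⟩
    exact ⟨J ⊓ L, F.inf_mem hJ hL, fun x hx => by rw [add_mul, ha x hx.1, hb x hx.2, add_zero]⟩
  zero_mem' := ⟨⊤, F.top_mem, fun x _ => zero_mul x⟩
  smul_mem' := by
    rintro c a ⟨J, hJ, ha⟩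
    exact ⟨J, hJ, fun x hx => by rw [smul_eq_mul, mul_assoc, ha x hx, mul_zero]⟩

instance : F.torsion.IsTwoSided where
  mul_mem_of_left := by
    rintro a b ⟨J, hJ, ha⟩
    exact ⟨J.colon b, F.colon_mem hJ b, fun x hx => by rw [mul_assoc]; exact ha _ hx⟩

/-- The topology induced on the ring `A / t(A)`: a right ideal is open if and only if its preimage
in `A` is open. -/
def modTorsion : GabrielTopology (A ⧸ F.torsion) where
  opens := {J | J.comap (Ideal.Quotient.mk F.torsion) ∈ F.opens}
  top_mem := F.mem_of_le F.top_mem fun _ _ => trivial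
  mem_of_le hJ h := F.mem_of_le hJ fun _ hx => h hx
  inf_mem hJ hL := F.mem_of_le (F.inf_mem hJ hL) fun _ hx => hx
  colon_mem {J} hJ a := by
    obtain ⟨a, rfl⟩ := Ideal.Quotient.mk_surjective a
    refine F.mem_of_le (F.colon_mem hJ a) fun x hx => ?_
    simpa using hx
  mem_of_colon_mem {J L} hL h := by
    refine F.mem_of_colon_mem hL fun b hb => ?_
    refine F.mem_of_le (h _ hb) fun x hx => ?_
    simpa using hx

/-- The ring of right quotients `A_F` of `A` with respect to the Gabriel topology `F`: the direct
limit of `Hom_A(J, A / t(A))` over the open right ideals `J` of `A`, with composition of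
representatives as multiplication. Since `A / t(A)` is torsion free, every such homomorphism kills
`J ∩ t(A)`, so that this is the direct limit of `Hom(J', A / t(A))` over the open right ideals `J'`
of the ring `A / t(A)`. -/
abbrev RightQuotients : Type u := Germs F.modTorsion

/-- The canonical ring homomorphism `A → A_F`. -/
def toRightQuotients : A →+* F.RightQuotients :=
  (Germs.of F.modTorsion).comp (Ideal.Quotient.mk F.torsion)

end GabrielTopology

/-- An epimorphism in the category of rings. -/
def IsRingEpi {A B : Type u} [Ring A] [Ring B] (φ : A →+* B) : Prop :=
  ∀ (C : Type u) [Ring C] (α β : B →+* C), α.comp φ = β.comp φ → α = β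

/-- The map `J ⊗_ℤ B → B`, `x ⊗ b ↦ φ(x) b`. -/
noncomputable def flatMulMap {A B : Type u} [Ring A] [Ring B] (φ : A →+* B) (J : RightIdeal A) :
    J ⊗[ℤ] B →ₗ[ℤ] B :=
  TensorProduct.lift ((LinearMap.mul ℤ B).comp
    (φ.toAddMonoidHom.comp J.toAddSubgroup.subtype).toIntLinearMap)

/-- The kernel of the quotient map `J ⊗_ℤ B → J ⊗_A B`, where `B` is a left `A`-module via `φ`. -/
def balancedRelations {A B : Type u} [Ring A] [Ring B] (φ : A →+* B) (J : RightIdeal A) :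
    Submodule ℤ (J ⊗[ℤ] B) :=
  Submodule.span ℤ {t | ∃ (x : J) (a : A) (b : B),
    t = (MulOpposite.op a • x) ⊗ₜ[ℤ] b - x ⊗ₜ[ℤ] (φ a * b)}

/-- `φ : A → B` makes `B` a flat left `A`-module: for every right ideal `J` of `A` the map
`J ⊗_A B → B`, `x ⊗ b ↦ φ(x) b`, is injective. -/
def IsLeftFlat {A B : Type u} [Ring A] [Ring B] (φ : A →+* B) : Prop :=
  ∀ J : RightIdeal A, LinearMap.ker (flatMulMap φ J) ≤ balancedRelations φ J

/-- The Gabriel topology `F` is perfect: `φ : A → A_F` is an epimorphism of rings that makes `A_F`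
a flat left `A`-module, and `J` is open if and only if `φ(J) A_F = A_F`. -/
def GabrielTopology.IsPerfect {A : Type u} [Ring A] (F : GabrielTopology A) : Prop :=
  IsRingEpi F.toRightQuotients ∧ IsLeftFlat F.toRightQuotients ∧
    ∀ J : RightIdeal A, J ∈ F.opens ↔
      Submodule.span (F.RightQuotients)ᵐᵒᵖ (F.toRightQuotients '' (J : Set A)) = ⊤

/-- The free right `R`-modules of ranks `i` and `j` are isomorphic. -/
def FreeRightModulesIso (R : Type u) [Ring R] (i j : ℕ) : Prop :=
  Nonempty ((Fin i → R) ≃ₗ[Rᵐᵒᵖ] (Fin j → R))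

/-- The nonzero ring `R` has module type `(p, q)`: `p ≥ 1` is the smallest rank of a free right
module that is isomorphic to a free right module of a larger rank, and `q` is the smallest
rank `> p` for which `R ^ p` and `R ^ q` are isomorphic. -/
def HasModuleType (R : Type u) [Ring R] (p q : ℕ) : Prop :=
  Nontrivial R ∧
  IsLeast {i : ℕ | 1 ≤ i ∧ ∃ j, i < j ∧ FreeRightModulesIso R i j} p ∧
  IsLeast {j : ℕ | p < j ∧ FreeRightModulesIso R p j} q

/-! Everything rests on the Schreier–Lewin formula: over the free algebra `A` of rank `n`, a
submodule of codimension `d` in a free right module of rank `r` is free of rank `d(n-1)+r`. Hence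
right ideals of finite codimension are free of finite positive rank. This makes `I ^ k` finitely
generated on the right, so all powers of `I` have finite codimension and define a Gabriel topology;
it is torsion free because `A` is a domain.

If an open right ideal has a finite basis `b`, its coordinate functionals are left multiplications
by elements `g i` of `Q`, and the row `φ (b j)` and the column `g i` are mutually inverse. The
equation `∑ φ (b j) * g j = 1` gives perfectness. The row and column together give `Q ≅ Q ^ rank`; a
maximal right ideal above `I` has codimension `lm`, so `Q ≅ Q ^ (lm(n-1)+1)`.

Conversely, an isomorphism `Q ≅ Q ^ j` embeds some `I ^ k` in `A ^ j` with an image `N` of finite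
codimension that contains a power of `I` in each coordinate. Comparing ranks gives `codim N * (n-1)
+ j = codim (I ^ k) * (n-1) + 1`. Both codimensions are multiples of `lm`, since the simple right
module of `M_m(D)` has dimension `lm`. So `j - 1` is a multiple of `lm(n-1)`, and `j > 1` bounds it
below. -/

section

open MulOpposite

/-! ### Schreier forests: monomial bases of finite dimensional quotients. -/

namespace FreeAlgebra

section Schreier

variable {K : Type*} [Field K] {n : ℕ} {ι : Type*}
  {M : Type*} [AddCommGroup M] [Module (FreeAlgebra K (Fin n))ᵐᵒᵖ M]

/-- The roots `e r` and the children `s p * x i` of the nodes `s p` of a rooted forest. -/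
def forestVal (e : ι → M) {d : ℕ} (s : Fin d → M) : ι ⊕ Fin d × Fin n → M
  | .inl r => e r
  | .inr (p, i) => op (FreeAlgebra.ι K i : FreeAlgebra K (Fin n)) • s p

/-- The family `s` is a forest with roots among the `e r`, in which the parent of each node has a
smaller index. -/
structure IsForest (e : ι → M) {d : ℕ} (s : Fin d → M) (par : Fin d → ι ⊕ Fin d × Fin n) :
    Prop where
  eq_val : ∀ k, s k = forestVal (K := K) e s (par k)
  lt : ∀ k p i, par k = .inr (p, i) → p < k

theorem IsForest.snoc {e : ι → M} {d : ℕ} {s : Fin d → M} {par : Fin d → ι ⊕ Fin d × Fin n}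
    (h : IsForest (K := K) e s par) (z : ι ⊕ Fin d × Fin n) :
    ∃ par', IsForest (K := K) (n := n) e
      (Fin.snoc s (forestVal (K := K) e s z) : Fin (d + 1) → M) par' := by
  let emb : ι ⊕ Fin d × Fin n → ι ⊕ Fin (d + 1) × Fin n := Sum.map id (Prod.map Fin.castSucc id)
  have hemb : ∀ w, forestVal (K := K) e
      (Fin.snoc s (forestVal (K := K) e s z) : Fin (d + 1) → M) (emb w) =
        forestVal (K := K) e s w := by
    rintro (r | ⟨p, i⟩)
    · rfl
    · simp [emb, forestVal]
  refine ⟨Fin.snoc (fun k => emb (par k)) (emb z), fun k => ?_, fun k p i => ?_⟩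
  · refine Fin.lastCases ?_ (fun k => ?_) k
    · rw [Fin.snoc_last, Fin.snoc_last, hemb]
    · rw [Fin.snoc_castSucc, Fin.snoc_castSucc, hemb, h.eq_val k]
  · refine Fin.lastCases ?_ (fun k => ?_) k
    · rw [Fin.snoc_last]
      rcases z with r | ⟨q, j⟩
      · simp [emb]
      · simp only [emb, Sum.map_inr, Prod.map, Sum.inr.injEq, Prod.mk.injEq]
        rintro ⟨rfl, _⟩
        exact Fin.castSucc_lt_last q
    · rw [Fin.snoc_castSucc]
      rcases hk : par k with r | ⟨q, j⟩
      · simp [emb]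
      · simp only [emb, Sum.map_inr, Prod.map, Sum.inr.injEq, Prod.mk.injEq]
        rintro ⟨rfl, _⟩
        exact Fin.castSucc_lt_castSucc_iff.2 (h.lt k q j hk)

variable [Module K M] [IsScalarTower K (FreeAlgebra K (Fin n))ᵐᵒᵖ M]

theorem algebraMap_op_smul (c : K) (y : M) :
    op (algebraMap K (FreeAlgebra K (Fin n)) c) • y = c • y := by
  have : op (algebraMap K (FreeAlgebra K (Fin n)) c) =
      c • (1 : (FreeAlgebra K (Fin n))ᵐᵒᵖ) := by
    rw [Algebra.smul_def, mul_one]; rfl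
  rw [this, smul_assoc, one_smul]

theorem op_smul_mem_of_generators (U : Submodule K M)
    (hx : ∀ y ∈ U, ∀ i, op (FreeAlgebra.ι K i : FreeAlgebra K (Fin n)) • y ∈ U)
    (a : FreeAlgebra K (Fin n)) : ∀ y ∈ U, op a • y ∈ U := by
  refine FreeAlgebra.induction K (Fin n) (motive := fun a => ∀ y ∈ U, op a • y ∈ U)
    (fun r y hy => ?_) (fun i y hy => hx y hy i) (fun a b ha hb y hy => ?_)
    (fun a b ha hb y hy => ?_) a
  · rw [algebraMap_op_smul]; exact U.smul_mem _ hy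
  · rw [op_mul, mul_smul]; exact hb _ (ha _ hy)
  · rw [op_add, add_smul]; exact U.add_mem (ha _ hy) (hb _ hy)

theorem eq_top_of_generators [Finite ι] (e : Module.Basis ι (FreeAlgebra K (Fin n))ᵐᵒᵖ M)
    (U : Submodule K M)
    (he : ∀ r, e r ∈ U)
    (hx : ∀ y ∈ U, ∀ i, op (FreeAlgebra.ι K i : FreeAlgebra K (Fin n)) • y ∈ U) : U = ⊤ := by
  cases nonempty_fintype ι
  refine eq_top_iff.2 fun y _ => ?_
  rw [← e.sum_repr y]
  exact U.sum_mem fun r _ => op_smul_mem_of_generators U hx (unop (e.repr y r)) _ (he r)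

variable (N : Submodule (FreeAlgebra K (Fin n))ᵐᵒᵖ M)

/-- A finite dimensional quotient of a free module has a basis that is the image of a forest. -/
theorem exists_forest [Finite ι] [FiniteDimensional K (M ⧸ N)]
    (e : Module.Basis ι (FreeAlgebra K (Fin n))ᵐᵒᵖ M) :
    ∃ (d : ℕ) (s : Fin d → M) (par : Fin d → ι ⊕ Fin d × Fin n), IsForest (K := K) e s par ∧
      LinearIndependent K (fun k => N.mkQ (s k)) ∧
      ⊤ ≤ Submodule.span K (Set.range fun k => N.mkQ (s k)) := by
  classical
  let P : ℕ → Prop := fun d => ∃ (s : Fin d → M) (par : Fin d → ι ⊕ Fin d × Fin n),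
    IsForest (K := K) e s par ∧ LinearIndependent K (fun k => N.mkQ (s k))
  have h0 : P 0 := ⟨Fin.elim0, Fin.elim0, ⟨fun k => k.elim0, fun k => k.elim0⟩,
    linearIndependent_empty_type⟩
  have hb : ∀ d, P d → d ≤ Module.finrank K (M ⧸ N) := by
    rintro d ⟨s, par, -, hs⟩
    simpa using hs.fintype_card_le_finrank
  obtain ⟨d, ⟨s, par, hf, hs⟩, hd⟩ : ∃ d, P d ∧ ∀ d', P d' → d' ≤ d :=
    ⟨_, Nat.findGreatest_spec (P := P) (Nat.zero_le _) h0,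
      fun d' h => Nat.le_findGreatest (hb _ h) h⟩
  refine ⟨d, s, par, hf, hs, ?_⟩
  set W := Submodule.span K (Set.range fun k => N.mkQ (s k)) with hW
  -- By maximality of `d`, no root or child can be appended to the forest, so all of them lie in `W`
  -- modulo `N`.
  have hz : ∀ z : ι ⊕ Fin d × Fin n, N.mkQ (forestVal (K := K) e s z) ∈ W := by
    intro z
    by_contra hz
    obtain ⟨par', hp⟩ := hf.snoc z
    have hP : P (d + 1) := by
      refine ⟨_, par', hp, ?_⟩
      have h : (fun k => N.mkQ ((Fin.snoc s (forestVal (K := K) e s z) : Fin (d + 1) → M) k)) =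
          Fin.snoc (fun k => N.mkQ (s k)) (N.mkQ (forestVal (K := K) e s z)) := by
        funext k
        refine Fin.lastCases ?_ (fun k => ?_) k <;> simp
      rw [h]
      exact linearIndependent_finSnoc.2 ⟨hs, hz⟩
    have := hd _ hP
    omega
  have htop := eq_top_of_generators e (W.comap (N.mkQ.restrictScalars K)) (fun r => hz (.inl r)) ?_
  · intro y _
    obtain ⟨y, rfl⟩ := N.mkQ_surjective y
    exact htop.ge (Submodule.mem_top (x := y))
  · intro y hy i
    have hy' : N.mkQ y ∈ W := hy
    change N.mkQ (op (FreeAlgebra.ι K i) • y) ∈ W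
    rw [map_smul]
    generalize N.mkQ y = v at hy'
    induction hy' using Submodule.span_induction with
    | mem v hv =>
      obtain ⟨k, rfl⟩ := hv
      have := hz (.inr (k, i))
      simpa only [forestVal, map_smul] using this
    | zero => simp
    | add v w _ _ hv hw => rw [smul_add]; exact W.add_mem hv hw
    | smul c v _ hv => rw [smul_comm]; exact W.smul_mem _ hv

end Schreier

end FreeAlgebra

/-! ### The Schreier–Lewin formula. -/

namespace FreeAlgebra

section Schreier

variable {K : Type*} [Field K] {n : ℕ} {ι : Type*} [Fintype ι]
  {M : Type*} [AddCommGroup M] [Module (FreeAlgebra K (Fin n))ᵐᵒᵖ M] [Module K M]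
  [IsScalarTower K (FreeAlgebra K (Fin n))ᵐᵒᵖ M]

/-- The `K`-linear extension of `a` acting on `P` from the right by operators `T i`. -/
noncomputable def rightAction {P : Type*} [AddCommGroup P] [Module K P]
    (T : Fin n → Module.End K P) : FreeAlgebra K (Fin n) →ₐ[K] (Module.End K P)ᵐᵒᵖ :=
  FreeAlgebra.lift K fun i => op (T i)

@[simp] theorem rightAction_ι {P : Type*} [AddCommGroup P] [Module K P]
    (T : Fin n → Module.End K P) (i : Fin n) : rightAction T (FreeAlgebra.ι K i) = op (T i) := by
  simp [rightAction]

/-- The map out of a free right module over the free algebra to a space with operators `T i` that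
sends the basis vector `e r` to `p r`. -/
noncomputable def extendRight {P : Type*} [AddCommGroup P] [Module K P]
    (e : Module.Basis ι (FreeAlgebra K (Fin n))ᵐᵒᵖ M) (T : Fin n → Module.End K P) (p : ι → P) :
    M →ₗ[K] P where
  toFun y := ∑ r, (rightAction T (unop (e.repr y r))).unop (p r)
  map_add' y z := by simp [Finset.sum_add_distrib]
  map_smul' c y := by
    have : e.repr (c • y) = op (algebraMap K (FreeAlgebra K (Fin n)) c) • e.repr y := by
      rw [← map_smul, algebraMap_op_smul]
    simp [this, Finset.smul_sum, Algebra.algebraMap_eq_smul_one]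

theorem extendRight_basis {P : Type*} [AddCommGroup P] [Module K P]
    (e : Module.Basis ι (FreeAlgebra K (Fin n))ᵐᵒᵖ M) (T : Fin n → Module.End K P) (p : ι → P)
    (r : ι) : extendRight e T p (e r) = p r := by
  classical
  change ∑ r', (rightAction T (unop (e.repr (e r) r'))).unop (p r') = p r
  rw [Finset.sum_eq_single r]
  · simp
  · intro b _ hb
    simp [hb.symm]
  · simp

theorem extendRight_smul {P : Type*} [AddCommGroup P] [Module K P]
    (e : Module.Basis ι (FreeAlgebra K (Fin n))ᵐᵒᵖ M) (T : Fin n → Module.End K P) (p : ι → P)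
    (a : FreeAlgebra K (Fin n)) (y : M) :
    extendRight e T p (op a • y) = (rightAction T a).unop (extendRight e T p y) := by
  change ∑ r, (rightAction T (unop (e.repr (op a • y) r))).unop (p r) =
    (rightAction T a).unop (∑ r, (rightAction T (unop (e.repr y r))).unop (p r))
  simp

variable (N : Submodule (FreeAlgebra K (Fin n))ᵐᵒᵖ M)

/-- The **Schreier–Lewin formula**: a submodule of finite codimension `d` in a free right module of
rank `r` over the free algebra of rank `n` is free of rank `d * (n - 1) + r`. -/
theorem exists_basis_of_finiteDimensional_quotient [FiniteDimensional K (M ⧸ N)] (hn : 1 ≤ n)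
    (e : Module.Basis ι (FreeAlgebra K (Fin n))ᵐᵒᵖ M) :
    Nonempty (Module.Basis (Fin (Module.finrank K (M ⧸ N) * (n - 1) + Fintype.card ι))
      (FreeAlgebra K (Fin n))ᵐᵒᵖ N) := by
  classical
  obtain ⟨d, s, par, hf, hli, hsp⟩ := exists_forest N e
  let b : Module.Basis (Fin d) K (M ⧸ N) := .mk hli hsp
  have hb : ∀ k, b k = N.mkQ (s k) := fun k => by simp [b]
  let val : (ι ⊕ Fin d × Fin n) → M := forestVal (K := K) e s
  let coef : (ι ⊕ Fin d × Fin n) → (Fin d → K) := fun z => b.equivFun (N.mkQ (val z))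
  have hval : ∀ k, val (par k) = s k := fun k => (hf.eq_val k).symm
  have hcoef : ∀ k, coef (par k) = Pi.single k 1 := by
    intro k
    simp only [coef, hval, ← hb]
    funext t
    simp [Pi.single_apply, eq_comm]
  have hinj : Function.Injective par := by
    intro k t h
    by_contra hkt
    have := congrFun ((hcoef k).symm.trans ((congrArg coef h).trans (hcoef t))) k
    simp [hkt] at this
  -- The basis of `N`: each root or child that is not itself a node, minus its normal form in the
  -- span of the nodes.
  let γ : {z // z ∉ Set.range par} → M := fun c => val c - ∑ t, coef c t • s t
  have hγN : ∀ c, γ c ∈ N := by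
    intro c
    rw [← N.ker_mkQ, LinearMap.mem_ker]
    have h1 : N.mkQ (∑ t, coef c t • s t) = ∑ t, coef c t • b t := by
      rw [map_sum]
      exact Finset.sum_congr rfl fun t _ => by rw [hb]; rfl
    rw [map_sub, h1, b.sum_equivFun, sub_self]
  -- linear independence
  let σ : (ι ⊕ Fin d × Fin n) → (Fin d → K) × ({z // z ∉ Set.range par} → FreeAlgebra K (Fin n)) :=
    fun z => (coef z, fun c => if c.1 = z then 1 else 0)
  let T : Fin n →
      Module.End K ((Fin d → K) × ({z // z ∉ Set.range par} → FreeAlgebra K (Fin n))) := fun i =>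
    (Fintype.linearCombination K fun t => σ (.inr (t, i))) ∘ₗ LinearMap.fst K _ _ +
      LinearMap.inr K _ _ ∘ₗ
        (LinearMap.pi fun c => LinearMap.mulRight K (FreeAlgebra.ι K i) ∘ₗ LinearMap.proj c) ∘ₗ
          LinearMap.snd K _ _
  let f : M →ₗ[K] (Fin d → K) × ({z // z ∉ Set.range par} → FreeAlgebra K (Fin n)) :=
    extendRight e T fun r => σ (.inl r)
  have hσpar : ∀ k, σ (par k) = (Pi.single k 1, 0) := by
    intro k
    refine Prod.ext (hcoef k) (funext fun c => ?_)
    have : c.1 ≠ par k := fun h => c.2 ⟨k, h.symm⟩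
    simp [σ, this]
  -- Strong induction on the index, since a parent has a smaller index than its child.
  have hfs : ∀ (B : ℕ) (k : Fin d), k.1 < B → f (s k) = (Pi.single k 1, 0) := by
    intro B
    induction B with
    | zero => intro k hk; omega
    | succ B ih =>
      intro k hk
      rw [← hσpar, ← hval]
      rcases hp : par k with r | ⟨p, i⟩
      · exact extendRight_basis e T _ r
      · have hlt := hf.lt k p i hp
        have hfp := ih p (by have := Fin.lt_def.1 hlt; omega)
        have h1 : f (val (.inr (p, i))) = (rightAction T (FreeAlgebra.ι K i)).unop (f (s p)) :=
          extendRight_smul e T _ _ _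
        rw [h1, hfp, rightAction_ι]
        simp [T, Fintype.linearCombination_apply, Pi.single_apply, Prod.ext_iff]
  replace hfs : ∀ k, f (s k) = (Pi.single k 1, 0) := fun k => hfs _ k k.1.lt_succ_self
  have hfval : ∀ z, f (val z) = σ z := by
    rintro (r | ⟨p, i⟩)
    · exact extendRight_basis e T _ r
    · have h1 : f (val (.inr (p, i))) = (rightAction T (FreeAlgebra.ι K i)).unop (f (s p)) :=
          extendRight_smul e T _ _ _
      rw [h1, hfs, rightAction_ι]
      simp [T, Fintype.linearCombination_apply, Pi.single_apply, Prod.ext_iff]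
  have hfγ : ∀ c, f (γ c) = (0, Pi.single c 1) := by
    intro c
    simp only [γ, map_sub, hfval, map_sum, map_smul, hfs]
    refine Prod.ext ?_ ?_
    · funext t
      simp [σ, Prod.fst_sum, Finset.sum_apply, Pi.single_apply]
    · funext c'
      simp [σ, Prod.snd_sum, Pi.single_apply, Subtype.ext_iff]
  -- The second summand of the model is a free right module: there `T` is right multiplication.
  have hact : ∀ (a : FreeAlgebra K (Fin n)) (w : {z // z ∉ Set.range par} → FreeAlgebra K (Fin n)),
      (rightAction T a).unop (0, w) = (0, fun c => w c * a) := by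
    intro a
    refine FreeAlgebra.induction K (Fin n) (motive := fun a =>
      ∀ w : {z // z ∉ Set.range par} → FreeAlgebra K (Fin n), (rightAction T a).unop (0, w) = (0, fun c => w c * a))
      (fun r w => ?_) (fun i w => ?_) (fun a b ha hb w => ?_) (fun a b ha hb w => ?_) a
    · rw [AlgHom.commutes]
      refine Prod.ext ?_ (funext fun c => ?_)
      · simp [Algebra.algebraMap_eq_smul_one]
      · simp [Algebra.algebraMap_eq_smul_one]
    · rw [rightAction_ι]
      refine Prod.ext ?_ (funext fun c => ?_)
      · simp [T]
      · simp [T]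
    · rw [map_mul, unop_mul, Module.End.mul_apply, ha, hb]
      simp [mul_assoc]
    · rw [map_add, unop_add, LinearMap.add_apply, ha, hb]
      simp [mul_add, funext_iff]
  have hLI : LinearIndependent (FreeAlgebra K (Fin n))ᵐᵒᵖ γ := by
    refine Fintype.linearIndependent_iff.2 fun g hg c => ?_
    have h1 : f (∑ c, g c • γ c) = (0, fun c => unop (g c)) := by
      rw [map_sum]
      have h2 : ∀ c, f (g c • γ c) = (0, fun c' => if c' = c then unop (g c) else 0) := by
        intro c
        have h3 : f (g c • γ c) = (rightAction T (unop (g c))).unop (f (γ c)) :=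
          extendRight_smul e T _ (unop (g c)) _
        rw [h3, hfγ, hact]
        simp [Pi.single_apply]
      simp only [h2]
      refine Prod.ext ?_ (funext fun c' => ?_)
      · simp [Prod.fst_sum]
      · simp [Prod.snd_sum]
    rw [hg, map_zero] at h1
    have := congrFun (congrArg Prod.snd h1) c
    exact (unop_injective this).symm
  -- spanning
  let W := Submodule.span (FreeAlgebra K (Fin n))ᵐᵒᵖ (Set.range γ)
  -- `U` contains the roots and is stable under the generators, so it is all of `M`. Since `W ≤ N`
  -- and the nodes are independent modulo `N`, this gives `N ≤ W`.
  let U : Submodule K M := Submodule.span K (Set.range s) ⊔ W.restrictScalars K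
  have hvalU : ∀ z, val z ∈ U := by
    intro z
    by_cases hz : z ∈ Set.range par
    · obtain ⟨k, rfl⟩ := hz
      rw [hval]
      exact Submodule.mem_sup_left (Submodule.subset_span ⟨k, rfl⟩)
    · have : val z = (∑ t, coef z t • s t) + γ ⟨z, hz⟩ := by simp [γ]
      rw [this]
      refine Submodule.add_mem_sup (Submodule.sum_mem _ fun t _ => Submodule.smul_mem _ _
        (Submodule.subset_span ⟨t, rfl⟩)) (Submodule.subset_span (s := Set.range γ) ⟨_, rfl⟩)
  have hU : U = ⊤ := by
    refine eq_top_of_generators e U (fun r => hvalU (.inl r)) fun y hy i => ?_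
    obtain ⟨v, hv, w, hw, rfl⟩ := Submodule.mem_sup.1 hy
    rw [smul_add]
    refine U.add_mem ?_ (Submodule.mem_sup_right (W.smul_mem _ hw))
    induction hv using Submodule.span_induction with
    | mem v hv =>
      obtain ⟨k, rfl⟩ := hv
      exact hvalU (.inr (k, i))
    | zero => simp
    | add v w _ _ hv hw =>
      rw [smul_add]
      exact U.add_mem (hv (Submodule.mem_sup.2 ⟨_, ‹_›, _, ‹_›, rfl⟩))
        (hw (Submodule.mem_sup.2 ⟨_, ‹_›, _, ‹_›, rfl⟩))
    | smul c v _ hv =>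
      rw [smul_comm]
      exact U.smul_mem _ (hv (Submodule.mem_sup.2 ⟨_, ‹_›, _, ‹_›, rfl⟩))
  have hWN : W ≤ N := Submodule.span_le.2 (by rintro _ ⟨c, rfl⟩; exact hγN c)
  have hNW : N ≤ W := by
    intro y hy
    obtain ⟨v, hv, w, hw, rfl⟩ := Submodule.mem_sup.1 (hU.ge (Submodule.mem_top (x := y)))
    obtain ⟨g, rfl⟩ := (Submodule.mem_span_range_iff_exists_fun K).1 hv
    have h1 : N.mkQ (∑ t, g t • s t) = 0 := by
      rw [← LinearMap.mem_ker, N.ker_mkQ]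
      simpa using N.sub_mem hy (hWN hw)
    have h2 : ∑ t, g t • N.mkQ (s t) = 0 := by
      rw [← h1, map_sum]
      exact Finset.sum_congr rfl fun t _ => rfl
    have h3 := Fintype.linearIndependent_iff.1 hli g h2
    simpa [h3] using hw
  -- There are `r + d * n` roots and children, of which `d` are nodes, `par` being injective.
  have hcard : Fintype.card {z // z ∉ Set.range par} =
      Module.finrank K (M ⧸ N) * (n - 1) + Fintype.card ι := by
    rw [Module.finrank_eq_card_basis b, Fintype.card_fin]
    have h1 : Fintype.card {z // z ∉ Set.range par} =
        Fintype.card (ι ⊕ Fin d × Fin n) - Fintype.card (Set.range par) :=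
      Fintype.card_subtype_compl _
    rw [h1, Set.card_range_of_injective hinj]
    simp only [Fintype.card_sum, Fintype.card_prod, Fintype.card_fin]
    obtain ⟨n, rfl⟩ : ∃ n', n = n' + 1 := ⟨n - 1, by omega⟩
    rw [Nat.mul_succ, Nat.add_sub_cancel]
    omega
  let γ' : {z // z ∉ Set.range par} → N := fun c => ⟨γ c, hγN c⟩
  have hli' : LinearIndependent (FreeAlgebra K (Fin n))ᵐᵒᵖ γ' :=
    LinearIndependent.of_comp N.subtype hLI
  have hsp' : ⊤ ≤ Submodule.span (FreeAlgebra K (Fin n))ᵐᵒᵖ (Set.range γ') := by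
    rintro ⟨y, hy⟩ -
    have hy' := hNW hy
    obtain ⟨g, hg⟩ := (Submodule.mem_span_range_iff_exists_fun _).1 hy'
    exact (Submodule.mem_span_range_iff_exists_fun _).2 ⟨g, Subtype.ext (by simpa [γ'] using hg)⟩
  exact ⟨(Module.Basis.mk hli' hsp').reindex (Fintype.equivFinOfCardEq hcard)⟩

end Schreier

end FreeAlgebra

/-! ### The ring of right quotients in the torsion free case. -/

namespace GabrielTopology

variable {A : Type*} [Ring A] (F : GabrielTopology A)

/-- The properties that characterize the ring of right quotients of a ring that is torsion free with
respect to a Gabriel topology. -/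
structure IsQuotientMap {Q : Type*} [Ring Q] (φ : A →+* Q) : Prop where
  injective : Function.Injective φ
  exists_mul_mem_range : ∀ q : Q, ∃ J ∈ F.opens, ∀ x ∈ J, ∃ a, q * φ x = φ a
  exists_eq_mul : ∀ J ∈ F.opens, ∀ h : J →ₗ[Aᵐᵒᵖ] A, ∃ q : Q, ∀ x : J, q * φ x = φ (h x)
  eq_zero_of_mul_eq_zero : ∀ J ∈ F.opens, ∀ q : Q, (∀ x ∈ J, q * φ x = 0) → q = 0

variable {F}

/-- Multiplying a germ by `φ x` evaluates it at `x`; this is right linearity of `f`. -/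
theorem mk_mul_toRightQuotients (f : PartialHom F.modTorsion) {x a : A}
    (hx : Ideal.Quotient.mk F.torsion x ∈ f.dom)
    (h : f.hom ⟨_, hx⟩ = Ideal.Quotient.mk F.torsion a) :
    Germs.mk f * F.toRightQuotients x = F.toRightQuotients a := by
  refine Germs.mk_eq_mk.2 ⟨_, PartialHom.compDom_mem _ _, le_rfl, fun _ _ => trivial, ?_⟩
  rintro y ⟨hy, hy'⟩
  change f.hom ⟨Ideal.Quotient.mk F.torsion x * y, hy'⟩ = Ideal.Quotient.mk F.torsion a * y
  rw [← h]
  exact f.hom.map_smul (MulOpposite.op y) ⟨_, hx⟩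

theorem mk_eq_zero_of_toRightQuotients_eq_zero (hT : F.torsion = ⊥) {a : A}
    (h : F.toRightQuotients a = 0) : a = 0 := by
  obtain ⟨J, hJ, _, _, h0⟩ := Germs.mk_eq_mk.1 h
  have ha : a ∈ F.torsion := by
    refine ⟨_, hJ, fun x hx => ?_⟩
    have h1 : Ideal.Quotient.mk F.torsion a * Ideal.Quotient.mk F.torsion x =
        0 * Ideal.Quotient.mk F.torsion x := h0 _ hx
    rw [zero_mul, ← map_mul, Ideal.Quotient.eq_zero_iff_mem, hT] at h1
    exact h1
  rwa [hT] at ha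

/-- Without torsion, `A → A / t(A)` is an isomorphism `ψ`, and homomorphisms on open right ideals
are transported along it. -/
theorem isQuotientMap_toRightQuotients (hT : F.torsion = ⊥) :
    F.IsQuotientMap F.toRightQuotients := by
  have hbij : Function.Bijective (Ideal.Quotient.mk F.torsion) := by
    refine ⟨(injective_iff_map_eq_zero _).2 fun a ha => ?_, Ideal.Quotient.mk_surjective⟩
    rwa [Ideal.Quotient.eq_zero_iff_mem, hT] at ha
  let ψ : A ≃+* A ⧸ F.torsion := RingEquiv.ofBijective _ hbij
  have hopen : ∀ J ∈ F.opens, J.comap (ψ.symm : A ⧸ F.torsion →+* A) ∈ F.modTorsion.opens := by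
    intro J hJ
    refine F.mem_of_le hJ fun x hx => ?_
    have : ψ.symm (Ideal.Quotient.mk F.torsion x) = x := ψ.symm_apply_apply x
    simpa [this] using hx
  refine ⟨(injective_iff_map_eq_zero _).2 fun a => mk_eq_zero_of_toRightQuotients_eq_zero hT,
    ?_, ?_, ?_⟩
  · refine Germs.ind fun f => ⟨_, f.dom_mem, fun x hx => ?_⟩
    obtain ⟨a, ha⟩ := Ideal.Quotient.mk_surjective (f.hom ⟨_, hx⟩)
    exact ⟨a, mk_mul_toRightQuotients f hx ha.symm⟩
  · intro J hJ h
    let f : PartialHom F.modTorsion :=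
      { dom := J.comap (ψ.symm : A ⧸ F.torsion →+* A)
        dom_mem := hopen J hJ
        hom :=
          { toFun := fun b => ψ (h ⟨ψ.symm b.1, b.2⟩)
            map_add' := fun b c => by
              rw [← map_add, ← map_add]
              congr 2
              exact Subtype.ext (map_add ψ.symm _ _)
            map_smul' := fun r b => by
              have h1 : (⟨ψ.symm (r • b).1, (r • b).2⟩ : J) =
                  MulOpposite.op (ψ.symm r.unop) • ⟨ψ.symm b.1, b.2⟩ :=
                Subtype.ext (map_mul ψ.symm _ _)
              rw [h1, map_smul]
              change ψ (h _ * ψ.symm r.unop) = ψ (h _) * r.unop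
              rw [map_mul, ψ.apply_symm_apply] } }
    refine ⟨Germs.mk f, fun x => mk_mul_toRightQuotients f (x := x.1) (a := h x) ?_ ?_⟩
    · change ψ.symm (ψ x.1) ∈ J
      rw [ψ.symm_apply_apply]
      exact x.2
    · change ψ (h ⟨ψ.symm (ψ x.1), _⟩) = ψ (h x)
      congr 2
      exact Subtype.ext (ψ.symm_apply_apply x.1)
  · intro J hJ
    refine Germs.ind fun f hf => ?_
    refine Germs.mk_eq_mk.2 ⟨_, F.modTorsion.inf_mem f.dom_mem (hopen J hJ), inf_le_left,
      fun _ _ => trivial, ?_⟩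
    rintro y ⟨hy, hyJ⟩
    obtain ⟨x, rfl⟩ := ψ.surjective y
    obtain ⟨a, ha⟩ := ψ.surjective (f.hom ⟨_, hy⟩)
    have hx : x ∈ J := by
      have hyJ' : ψ.symm (ψ x) ∈ J := hyJ
      rwa [ψ.symm_apply_apply] at hyJ'
    have h1 := mk_mul_toRightQuotients f (x := x) hy ha.symm
    rw [hf x hx] at h1
    have h2 := mk_eq_zero_of_toRightQuotients_eq_zero hT h1.symm
    rw [h2, map_zero] at ha
    exact ha.symm.trans (zero_mul _).symm

end GabrielTopology

/-! ### Perfectness from free open right ideals. -/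

namespace GabrielTopology.IsQuotientMap

variable {A : Type u} [Ring A] {F : GabrielTopology A} {Q : Type u} [Ring Q] {φ : A →+* Q}

/-- The `g i` represent the coordinate functionals. The expansion of `x` in the basis says that `∑ φ
(b j) * g j - 1` kills `φ(J)`, hence vanishes. -/
theorem exists_dual_basis (hφ : F.IsQuotientMap φ) {J : RightIdeal A} (hJ : J ∈ F.opens) {m : ℕ}
    (b : Module.Basis (Fin m) Aᵐᵒᵖ J) :
    ∃ g : Fin m → Q, ∑ j, φ (b j) * g j = 1 ∧
      ∀ i j, g i * φ (b j) = if i = j then 1 else 0 := by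
  let c : Fin m → J →ₗ[Aᵐᵒᵖ] A := fun i =>
    { toFun := fun x => (b.repr x i).unop
      map_add' := fun x y => by simp
      map_smul' := fun r x => by simp }
  choose g hg using fun i => hφ.exists_eq_mul J hJ (c i)
  refine ⟨g, sub_eq_zero.1 (hφ.eq_zero_of_mul_eq_zero J hJ _ fun x hx => ?_), fun i j => ?_⟩
  · rw [sub_mul, one_mul, sub_eq_zero, Finset.sum_mul]
    have h1 : x = ∑ j, (b j : A) * c j ⟨x, hx⟩ := by
      have := congrArg Subtype.val (b.sum_repr ⟨x, hx⟩)
      rw [Submodule.coe_sum] at this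
      exact this.symm
    conv_rhs => rw [h1, map_sum]
    exact Finset.sum_congr rfl fun j _ => by rw [mul_assoc, map_mul, hg j ⟨x, hx⟩]
  · rw [hg i (b j)]
    change φ (b.repr (b j) i).unop = _
    by_cases h : i = j
    · simp [h]
    · simp [h]

/-- Every open right ideal contains an open right ideal that is free of finite rank. -/
def _root_.GabrielTopology.HasFreeOpens (F : GabrielTopology A) : Prop :=
  ∀ J ∈ F.opens, ∃ L ∈ F.opens, L ≤ J ∧ ∃ m : ℕ, Nonempty (Module.Basis (Fin m) Aᵐᵒᵖ L)

variable (hφ : F.IsQuotientMap φ) (hF : F.HasFreeOpens)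
include hφ hF

theorem exists_sum_eq_one {J : RightIdeal A} (hJ : J ∈ F.opens) :
    ∃ (m : ℕ) (e : Fin m → A) (g : Fin m → Q), (∀ j, e j ∈ J) ∧ ∑ j, φ (e j) * g j = 1 := by
  obtain ⟨L, hL, hLJ, m, ⟨b⟩⟩ := hF J hJ
  obtain ⟨g, hg, -⟩ := hφ.exists_dual_basis hL b
  exact ⟨m, fun j => b j, g, fun j => hLJ (b j).2, hg⟩

/-- A zigzag argument: `q * φ (e j)` and `φ (e j)` lie in `φ(A)`, where `α` and `β` agree, and the
decomposition of one recovers `q`. -/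
theorem isRingEpi : IsRingEpi φ := by
  intro C _ α β h
  have h' : ∀ a, α (φ a) = β (φ a) := fun a => RingHom.congr_fun h a
  ext q
  obtain ⟨J, hJ, hq⟩ := hφ.exists_mul_mem_range q
  obtain ⟨m, e, g, he, heg⟩ := hφ.exists_sum_eq_one hF hJ
  calc α q = α q * β (∑ j, φ (e j) * g j) := by rw [heg, map_one, mul_one]
    _ = ∑ j, α q * β (φ (e j)) * β (g j) := by
      rw [map_sum, Finset.mul_sum]
      exact Finset.sum_congr rfl fun j _ => by rw [map_mul, mul_assoc]
    _ = ∑ j, β q * β (φ (e j)) * β (g j) := by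
      refine Finset.sum_congr rfl fun j _ => ?_
      obtain ⟨a, ha⟩ := hq _ (he j)
      rw [← map_mul, ← h' (e j), ← map_mul, ha, h']
    _ = β q * β (∑ j, φ (e j) * g j) := by
      rw [map_sum, Finset.mul_sum]
      exact Finset.sum_congr rfl fun j _ => by rw [map_mul, mul_assoc]
    _ = β q := by rw [heg, map_one, mul_one]

omit hF in
/-- Elements of `J ⊗ Q` can be rewritten in terms of a decomposition of one. -/
theorem exists_sub_sum_mem_balancedRelations (J : RightIdeal A) (t : J ⊗[ℤ] Q) :
    -- `L` comes before the decomposition of one, so that a single decomposition serves all summands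
    -- of `t`.
    ∃ L ∈ F.opens, ∀ (m : ℕ) (e : Fin m → A) (g : Fin m → Q), (∀ j, e j ∈ L) →
      ∑ j, φ (e j) * g j = 1 → ∃ y : Fin m → J,
        t - ∑ j, y j ⊗ₜ[ℤ] g j ∈ balancedRelations φ J ∧
          ∀ j, flatMulMap φ J t * φ (e j) = φ (y j) := by
  induction t using TensorProduct.induction_on with
  | zero => exact ⟨⊤, F.top_mem, fun m e g _ _ => ⟨0, by simp, by simp⟩⟩
  | tmul x q =>
    obtain ⟨L, hL, hq⟩ := hφ.exists_mul_mem_range q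
    refine ⟨L, hL, fun m e g he heg => ?_⟩
    choose a ha using fun j => hq _ (he j)
    refine ⟨fun j => MulOpposite.op (a j) • x, ?_, fun j => ?_⟩
    · have h1 : q = ∑ j, φ (a j) * g j := by
        rw [← mul_one q, ← heg, Finset.mul_sum]
        exact Finset.sum_congr rfl fun j _ => by rw [← mul_assoc, ha]
      rw [h1, TensorProduct.tmul_sum, ← Finset.sum_sub_distrib]
      refine Submodule.sum_mem _ fun j _ => ?_
      rw [← neg_sub]
      exact Submodule.neg_mem _ (Submodule.subset_span ⟨x, a j, g j, rfl⟩)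
    · change φ x * q * φ (e j) = φ (x * a j)
      rw [mul_assoc, ha, map_mul]
  | add t t' h h' =>
    obtain ⟨L, hL, h⟩ := h
    obtain ⟨L', hL', h'⟩ := h'
    refine ⟨L ⊓ L', F.inf_mem hL hL', fun m e g he heg => ?_⟩
    obtain ⟨y, hy, hy1⟩ := h m e g (fun j => (he j).1) heg
    obtain ⟨z, hz, hz1⟩ := h' m e g (fun j => (he j).2) heg
    refine ⟨y + z, ?_, fun j => ?_⟩
    · have := Submodule.add_mem _ hy hz
      simpa [TensorProduct.add_tmul, Finset.sum_add_distrib, add_sub_add_comm] using this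
    · rw [map_add, add_mul, hy1, hz1, ← map_add]
      rfl

/-- For `t` in the kernel, the coefficients `y j` satisfy `φ (y j) = 0`, so they vanish by
injectivity of `φ`. -/
theorem isLeftFlat : IsLeftFlat φ := by
  intro J t ht
  obtain ⟨L, hL, h⟩ := hφ.exists_sub_sum_mem_balancedRelations J t
  obtain ⟨m, e, g, he, heg⟩ := hφ.exists_sum_eq_one hF hL
  obtain ⟨y, hy, hy1⟩ := h m e g he heg
  have hy0 : ∀ j, y j = 0 := fun j => by
    have := hy1 j
    rw [LinearMap.mem_ker.1 ht, zero_mul, eq_comm, ← map_zero φ] at this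
    exact Subtype.ext (hφ.injective this)
  simpa [hy0] using hy

theorem mem_opens_iff (J : RightIdeal A) :
    J ∈ F.opens ↔ Submodule.span Qᵐᵒᵖ (φ '' (J : Set A)) = ⊤ := by
  constructor
  · intro hJ
    obtain ⟨m, e, g, he, heg⟩ := hφ.exists_sum_eq_one hF hJ
    have h1 : (1 : Q) ∈ Submodule.span Qᵐᵒᵖ (φ '' (J : Set A)) := by
      rw [← heg]
      refine Submodule.sum_mem _ fun j _ => ?_
      exact Submodule.smul_mem _ (MulOpposite.op (g j)) (Submodule.subset_span ⟨_, he j, rfl⟩)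
    refine eq_top_iff.2 fun q _ => ?_
    simpa using Submodule.smul_mem _ (MulOpposite.op q) h1
  · intro h
    -- Each element of `φ(J)Q` multiplies some open right ideal into `φ(J)`; for the element one,
    -- this puts an open right ideal inside `J`.
    have key : ∀ z ∈ Submodule.span Qᵐᵒᵖ (φ '' (J : Set A)),
        ∃ L ∈ F.opens, ∀ y ∈ L, ∃ x ∈ J, z * φ y = φ x := by
      intro z hz
      induction hz using Submodule.closure_induction with
      | zero => exact ⟨⊤, F.top_mem, fun y _ => ⟨0, J.zero_mem, by simp⟩⟩
      | add z w _ _ hz hw =>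
        obtain ⟨L, hL, hz⟩ := hz
        obtain ⟨L', hL', hw⟩ := hw
        refine ⟨L ⊓ L', F.inf_mem hL hL', fun y hy => ?_⟩
        obtain ⟨x, hx, hx1⟩ := hz y hy.1
        obtain ⟨x', hx', hx1'⟩ := hw y hy.2
        exact ⟨x + x', J.add_mem hx hx', by rw [add_mul, hx1, hx1', map_add]⟩
      | smul_mem r z hz =>
        obtain ⟨x, hx, rfl⟩ := hz
        obtain ⟨L, hL, hq⟩ := hφ.exists_mul_mem_range r.unop
        refine ⟨L, hL, fun y hy => ?_⟩
        obtain ⟨a, ha⟩ := hq y hy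
        refine ⟨x * a, RightIdeal.mul_mem_right hx a, ?_⟩
        change φ x * r.unop * φ y = _
        rw [mul_assoc, ha, map_mul]
    obtain ⟨L, hL, h1⟩ := key 1 (h.ge Submodule.mem_top)
    refine F.mem_of_le hL fun y hy => ?_
    obtain ⟨x, hx, hxy⟩ := h1 y hy
    rw [one_mul] at hxy
    rwa [hφ.injective hxy]

end GabrielTopology.IsQuotientMap

theorem GabrielTopology.isPerfect_of_hasFreeOpens {A : Type u} [Ring A] {F : GabrielTopology A}
    (hT : F.torsion = ⊥) (hF : F.HasFreeOpens) : F.IsPerfect :=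
  have hφ := isQuotientMap_toRightQuotients hT
  ⟨hφ.isRingEpi hF, hφ.isLeftFlat hF, hφ.mem_opens_iff hF⟩

/-- A two-sided ideal as a right ideal. -/
def Ideal.toRightIdeal {A : Type u} [Ring A] (I : Ideal A) [I.IsTwoSided] : RightIdeal A where
  carrier := I
  add_mem' := I.add_mem
  zero_mem' := I.zero_mem
  smul_mem' c _ hx := I.mul_mem_right c.unop hx

theorem Ideal.mem_toRightIdeal {A : Type u} [Ring A] {I : Ideal A} [I.IsTwoSided] {x : A} :
    x ∈ I.toRightIdeal ↔ x ∈ I := Iff.rfl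

theorem RightIdeal.pow_add_subset {A : Type u} [Ring A] {I : Ideal A} [I.IsTwoSided] {i j : ℕ}
    {J : RightIdeal A} (h : ∀ x ∈ I ^ i, ∀ y ∈ I ^ j, x * y ∈ J) :
    ((I ^ (i + j) : Ideal A) : Set A) ⊆ J := by
  intro z hz
  rw [SetLike.mem_coe, Ideal.IsTwoSided.pow_add] at hz
  exact Submodule.mul_induction_on hz h fun x y hx hy => J.add_mem hx hy

theorem RightIdeal.exists_eq_sum {A : Type u} [Ring A] {ι : Type*} [Fintype ι] {J : RightIdeal A}
    (b : Module.Basis ι Aᵐᵒᵖ J) {x : A} (hx : x ∈ J) : ∃ c : ι → A, x = ∑ j, (b j : A) * c j := by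
  have h := congrArg Subtype.val (b.sum_repr ⟨x, hx⟩)
  rw [Submodule.coe_sum] at h
  exact ⟨fun j => (b.repr ⟨x, hx⟩ j).unop, h.symm⟩

theorem Submodule.finiteDimensional_quotient_iff {K R M : Type*} [Field K] [Ring R] [SMul K R]
    [AddCommGroup M] [Module R M] [Module K M] [IsScalarTower K R M] (N : Submodule R M) :
    FiniteDimensional K (M ⧸ N) ↔ ∃ W : Submodule K M, W.FG ∧ ∀ x, ∃ w ∈ W, x - w ∈ N := by
  constructor
  · intro h
    obtain ⟨W, hW⟩ := (N.restrictScalars K).exists_isCompl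
    have e := (Submodule.Quotient.restrictScalarsEquiv K N).symm.trans
      (Submodule.quotientEquivOfIsCompl _ _ hW)
    refine ⟨W, Module.Finite.iff_fg.1 (Module.Finite.equiv e), fun x => ?_⟩
    obtain ⟨y, hy, w, hw, rfl⟩ := Submodule.mem_sup.1 (hW.sup_eq_top.ge (Submodule.mem_top (x := x)))
    exact ⟨w, hw, by simpa using hy⟩
  · rintro ⟨W, hW, h⟩
    have := Module.Finite.iff_fg.2 hW
    refine Module.Finite.of_surjective ((N.mkQ.restrictScalars K) ∘ₗ W.subtype) fun y => ?_
    obtain ⟨x, rfl⟩ := N.mkQ_surjective y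
    obtain ⟨w, hw, hx⟩ := h x
    refine ⟨⟨w, hw⟩, ?_⟩
    exact ((Submodule.Quotient.eq N).2 hx).symm

/-- Every ring is free of rank one as a right module over itself. -/
def MulOpposite.unopLinearEquiv (A : Type*) [Ring A] : Aᵐᵒᵖ ≃ₗ[Aᵐᵒᵖ] A where
  toFun := unop
  invFun := op
  left_inv _ := rfl
  right_inv _ := rfl
  map_add' _ _ := rfl
  map_smul' _ _ := rfl

/-! ### The `I`-adic topology on the free algebra. -/

namespace FreeAlgebra

variable {K : Type u} [Field K] {n : ℕ} {I : Ideal (FreeAlgebra K (Fin n))} [I.IsTwoSided]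

theorem exists_basis_rightIdeal (hn : 1 ≤ n) (J : RightIdeal (FreeAlgebra K (Fin n)))
    [FiniteDimensional K (FreeAlgebra K (Fin n) ⧸ J)] :
    Nonempty (Module.Basis (Fin (Module.finrank K (FreeAlgebra K (Fin n) ⧸ J) * (n - 1) + 1))
      (FreeAlgebra K (Fin n))ᵐᵒᵖ J) :=
  exists_basis_of_finiteDimensional_quotient J hn
    ((Module.Basis.singleton (Fin 1) (FreeAlgebra K (Fin n))ᵐᵒᵖ).map
      (MulOpposite.unopLinearEquiv _))

variable (hn : 1 ≤ n) (hI : FiniteDimensional K (FreeAlgebra K (Fin n) ⧸ I))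
include hn hI

/-- By the inductive hypothesis `I ^ k` has a finite basis `b`. Since `b j * I ⊆ I ^ (k+1)`, the
coefficients of the `b j` matter only modulo `I`, so finitely many dimensions are added. -/
theorem finiteDimensional_quotient_pow (k : ℕ) :
    FiniteDimensional K (FreeAlgebra K (Fin n) ⧸ (I ^ k).toRightIdeal) := by
  induction k with
  | zero =>
    refine (Submodule.finiteDimensional_quotient_iff _).2 ⟨⊥, Submodule.fg_bot, fun x => ?_⟩
    refine ⟨0, zero_mem _, ?_⟩
    rw [Ideal.mem_toRightIdeal, Submodule.pow_zero, Ideal.one_eq_top]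
    trivial
  | succ k ih =>
    obtain ⟨b⟩ := exists_basis_rightIdeal hn (I ^ k).toRightIdeal
    obtain ⟨W, hW, hW'⟩ := (Submodule.finiteDimensional_quotient_iff _).1 ih
    obtain ⟨V, hV, hV'⟩ := (Submodule.finiteDimensional_quotient_iff _).1 hI
    choose v hv hv' using hV'
    refine (Submodule.finiteDimensional_quotient_iff _).2
      ⟨W ⊔ ⨆ j, V.map (LinearMap.mulLeft K (b j : FreeAlgebra K (Fin n))),
        hW.sup (Submodule.fg_iSup _ fun j => hV.map _), fun x => ?_⟩
    obtain ⟨w, hw, hx⟩ := hW' x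
    obtain ⟨c, hc⟩ := RightIdeal.exists_eq_sum b hx
    refine ⟨w + ∑ j, (b j : FreeAlgebra K (Fin n)) * v (c j),
      Submodule.add_mem_sup hw (Submodule.sum_mem _ fun j _ =>
        Submodule.mem_iSup_of_mem j ⟨_, hv _, rfl⟩), ?_⟩
    rw [← sub_sub, hc, ← Finset.sum_sub_distrib]
    refine Submodule.sum_mem _ fun j _ => ?_
    rw [← mul_sub, Ideal.mem_toRightIdeal, Submodule.pow_succ]
    exact Ideal.mul_mem_mul (b j).2 (hv' _)

/-- The `I`-adic topology on a free algebra, for an ideal `I` of finite codimension. -/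
def adicTopology : GabrielTopology (FreeAlgebra K (Fin n)) where
  opens := {J | ∃ k : ℕ, ((I ^ k : Ideal _) : Set (FreeAlgebra K (Fin n))) ⊆ J}
  top_mem := ⟨0, fun _ _ => trivial⟩
  mem_of_le := fun ⟨k, hk⟩ h => ⟨k, hk.trans h⟩
  inf_mem := fun ⟨k, hk⟩ ⟨k', hk'⟩ => ⟨max k k', fun _ hx =>
    ⟨hk (Ideal.pow_le_pow_right (le_max_left _ _) hx),
      hk' (Ideal.pow_le_pow_right (le_max_right _ _) hx)⟩⟩
  colon_mem := fun ⟨k, hk⟩ a => ⟨k, fun _ hx => hk ((I ^ k).mul_mem_left a hx)⟩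
  mem_of_colon_mem := by
    rintro J L ⟨k, hk⟩ h
    have := finiteDimensional_quotient_pow hn hI k
    obtain ⟨b⟩ := exists_basis_rightIdeal hn (I ^ k).toRightIdeal
    -- Finite generation of `I ^ k` turns the exponents for single elements into one uniform
    -- exponent.
    choose i hi using fun j => h (b j) (hk (b j).2)
    refine ⟨k + Finset.univ.sup i, RightIdeal.pow_add_subset fun x hx y hy => ?_⟩
    obtain ⟨c, rfl⟩ := RightIdeal.exists_eq_sum b hx
    rw [Finset.sum_mul]
    refine J.sum_mem fun j _ => ?_
    rw [mul_assoc]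
    exact hi j (Ideal.mul_mem_left _ _
      (Ideal.pow_le_pow_right (Finset.le_sup (Finset.mem_univ j)) hy))

theorem pow_mem_adicTopology (k : ℕ) : (I ^ k).toRightIdeal ∈ (adicTopology hn hI).opens :=
  ⟨k, subset_rfl⟩

theorem hasFreeOpens_adicTopology : (adicTopology hn hI).HasFreeOpens := by
  rintro J ⟨k, hk⟩
  have := finiteDimensional_quotient_pow hn hI k
  exact ⟨_, pow_mem_adicTopology hn hI k, hk, _, exists_basis_rightIdeal hn _⟩

/-- The free algebra is a domain, and `I ^ k` is nonzero because its rank, a successor, is positive.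
-/
theorem torsion_adicTopology : (adicTopology hn hI).torsion = ⊥ := by
  refine eq_bot_iff.2 ?_
  rintro a ⟨J, ⟨k, hk⟩, ha⟩
  have := finiteDimensional_quotient_pow hn hI k
  obtain ⟨b⟩ := exists_basis_rightIdeal hn (I ^ k).toRightIdeal
  have h0 : (b 0 : FreeAlgebra K (Fin n)) ≠ 0 := fun h => b.ne_zero 0 (Subtype.ext h)
  exact (mul_eq_zero.1 (ha _ (hk (b 0).2))).resolve_right h0

theorem isPerfect_adicTopology : (adicTopology hn hI).IsPerfect :=
  GabrielTopology.isPerfect_of_hasFreeOpens (torsion_adicTopology hn hI)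
    (hasFreeOpens_adicTopology hn hI)

end FreeAlgebra

/-! ### Divisibility of dimensions by `lm`. -/

/-- A right module over a matrix ring over a division algebra `D` has dimension divisible by the
dimension of a row. -/
theorem Matrix.finrank_dvd_of_rightAction {K D W ι : Type*} [Field K] [DivisionRing D] [Algebra K D]
    [FiniteDimensional K D] [AddCommGroup W] [Module K W] [FiniteDimensional K W] [Fintype ι]
    [DecidableEq ι] (o : ι) (ρ : Matrix ι ι D →ₐ[K] (Module.End K W)ᵐᵒᵖ) :
    Module.finrank K D * Fintype.card ι ∣ Module.finrank K W := by
  let T : Matrix ι ι D → Module.End K W := fun X => (ρ X).unop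
  have hT : ∀ X Y w, T (X * Y) w = T Y (T X w) := fun X Y w => by simp [T]
  have hT1 : ∀ w, T 1 w = w := fun w => by simp [T]
  have hTadd : ∀ (s : Finset ι) (X : ι → Matrix ι ι D) w,
      T (∑ i ∈ s, X i) w = ∑ i ∈ s, T (X i) w := fun s X w => by
    simp [T, Finset.unop_sum, LinearMap.sum_apply]
  let τ : Dᵐᵒᵖ →ₐ[K] Module.End K W :=
    { toFun := fun d => T (Matrix.scalar ι d.unop)
      map_one' := by simp [T]
      map_zero' := by simp [T]
      map_add' := fun a b => by simp only [T, unop_add, map_add]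
      map_mul' := fun a b => by simp only [T, unop_mul, map_mul]
      commutes' := fun r => by
        have h : Matrix.scalar ι (algebraMap K Dᵐᵒᵖ r).unop = algebraMap K (Matrix ι ι D) r := by
          rw [Matrix.algebraMap_eq_diagonal]; rfl
        simp only [T, h, AlgHom.commutes]
        rfl }
  let _ : Module Dᵐᵒᵖ W := Module.compHom W (τ : Dᵐᵒᵖ →+* Module.End K W)
  have hsmul : ∀ (d : Dᵐᵒᵖ) (w : W), d • w = T (Matrix.scalar ι d.unop) w := fun _ _ => rfl
  have : IsScalarTower K Dᵐᵒᵖ W := ⟨fun r d w => by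
    change τ (r • d) w = r • τ d w
    rw [map_smul]; rfl⟩
  let E : ι → ι → Matrix ι ι D := fun i j => Matrix.single i j 1
  -- The part `W e_oo`, a vector space over `Dᵐᵒᵖ`; the matrix units identify `W` with a sum of
  -- copies of it, one for each index.
  let W₀ : Submodule Dᵐᵒᵖ W :=
    { carrier := {w | T (E o o) w = w}
      add_mem' := fun {a b} ha hb => by
        change T (E o o) (a + b) = a + b
        rw [map_add, ha, hb]
      zero_mem' := map_zero _
      smul_mem' := fun d w hw => by
        change T (E o o) (d • w) = d • w
        rw [hsmul, ← hT]
        have h : Matrix.scalar ι d.unop * E o o = E o o * Matrix.scalar ι d.unop := by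
          ext i j
          simp [E, Matrix.single_apply]
        rw [h, hT, hw] }
  have hEE : ∀ i j k, E i j * E j k = E i k := fun i j k => by simp [E]
  have hEne : ∀ i j k l, j ≠ k → E i j * E k l = 0 := fun i j k l h => by
    simp [E, Matrix.single_mul_single_of_ne _ _ _ _ h]
  have hT0 : ∀ w, T 0 w = 0 := fun w => by simp [T]
  let f : W ≃ₗ[K] (ι → W₀) :=
    { toFun := fun w i => ⟨T (E i o) w, by
        change T (E o o) (T (E i o) w) = T (E i o) w
        rw [← hT, hEE]⟩
      map_add' := fun a b => by
        funext i
        exact Subtype.ext (map_add (T (E i o)) a b)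
      map_smul' := fun r a => by
        funext i
        exact Subtype.ext (map_smul (T (E i o)) r a)
      invFun := fun w => ∑ i, T (E o i) (w i)
      left_inv := fun w => by
        change ∑ i, T (E o i) (T (E i o) w) = w
        simp only [← hT, hEE]
        rw [← hTadd]
        have h : ∑ i, E i i = 1 := by
          ext i j
          rw [Matrix.sum_apply, Finset.sum_eq_single i]
          · simp [E, Matrix.single_apply, Matrix.one_apply]
          · intro k _ hk
            simp [E, hk]
          · simp
        rw [h, hT1]
      right_inv := fun w => by
        funext j
        refine Subtype.ext ?_
        change T (E j o) (∑ i, T (E o i) (w i)) = w j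
        rw [map_sum, Finset.sum_eq_single j]
        · rw [← hT, hEE]
          exact (w j).2
        · intro i _ hij
          rw [← hT, hEne _ _ _ _ hij, hT0]
        · simp }
  have : FiniteDimensional K W₀ := inferInstanceAs (FiniteDimensional K (W₀.restrictScalars K))
  have h1 : Module.finrank K W = Fintype.card ι * Module.finrank K W₀ := by
    rw [f.finrank_eq, Module.finrank_pi_fintype]
    simp
  have h2 : Module.finrank K Dᵐᵒᵖ * Module.finrank Dᵐᵒᵖ W₀ = Module.finrank K W₀ :=
    Module.finrank_mul_finrank K Dᵐᵒᵖ W₀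
  rw [h1, ← h2, ← (opLinearEquiv K : D ≃ₗ[K] Dᵐᵒᵖ).finrank_eq]
  exact ⟨Module.finrank Dᵐᵒᵖ W₀, by ring⟩

section

variable {K A D : Type*} [Field K] [Ring A] [Algebra K A] [DivisionRing D] [Algebra K D]
  [FiniteDimensional K D] {m : ℕ} {I : Ideal A} [I.IsTwoSided]

theorem finrank_dvd_of_smul_eq_zero (e : (A ⧸ I) ≃ₐ[K] Matrix (Fin m) (Fin m) D) (o : Fin m)
    {V : Type*} [AddCommGroup V] [Module K V] [Module Aᵐᵒᵖ V] [IsScalarTower K Aᵐᵒᵖ V]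
    [FiniteDimensional K V] (h : ∀ x ∈ I, ∀ v : V, op x • v = 0) :
    Module.finrank K D * m ∣ Module.finrank K V := by
  let ρ : A →ₐ[K] (Module.End K V)ᵐᵒᵖ := AlgHom.opComm.symm (Algebra.lsmul K K V)
  have hρ : ∀ a ∈ I, ρ a = 0 := fun a ha => unop_injective (LinearMap.ext (h a ha))
  have := Matrix.finrank_dvd_of_rightAction o ((Ideal.Quotient.liftₐ I ρ hρ).comp e.symm.toAlgHom)
  rwa [Fintype.card_fin] at this

/-- A finite dimensional right module that is annihilated by a power of `I`, where `A ⧸ I` is a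
matrix ring over `D`, has dimension divisible by that of the simple module. -/
theorem finrank_dvd_of_pow_smul_eq_zero (e : (A ⧸ I) ≃ₐ[K] Matrix (Fin m) (Fin m) D) (o : Fin m)
    (k : ℕ) {V : Type*} [AddCommGroup V] [Module K V] [Module Aᵐᵒᵖ V] [IsScalarTower K Aᵐᵒᵖ V]
    [FiniteDimensional K V] (h : ∀ x ∈ I ^ k, ∀ v : V, op x • v = 0) :
    Module.finrank K D * m ∣ Module.finrank K V := by
  induction k generalizing V with
  | zero =>
    have : Subsingleton V := ⟨fun v w => by
      have h1 : ∀ v : V, v = 0 := fun v => by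
        simpa using h 1 (by rw [Submodule.pow_zero, Ideal.one_eq_top]; trivial) v
      rw [h1 v, h1 w]⟩
    rw [Module.finrank_zero_of_subsingleton (M := V)]
    exact dvd_zero _
  | succ k ih =>
    -- `U = V I` is killed by `I ^ k`, and `V / U` is killed by `I`; dimensions add.
    let U : Submodule Aᵐᵒᵖ V := Submodule.span Aᵐᵒᵖ {u | ∃ x ∈ I, ∃ v, u = op x • v}
    have hU : ∀ u ∈ U, ∀ x ∈ I ^ k, op x • u = 0 := by
      intro u hu
      induction hu using Submodule.span_induction with
      | mem u hu =>
        obtain ⟨y, hy, v, rfl⟩ := hu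
        intro x hx
        rw [← mul_smul, ← op_mul]
        refine h _ ?_ v
        rw [Ideal.IsTwoSided.pow_succ]
        exact Ideal.mul_mem_mul hy hx
      | zero => simp
      | add u v _ _ hu hv => intro x hx; rw [smul_add, hu x hx, hv x hx, add_zero]
      | smul a u _ hu =>
        intro x hx
        rw [← mul_smul]
        exact hu _ ((I ^ k).mul_mem_left a.unop hx)
    have : FiniteDimensional K U := inferInstanceAs (FiniteDimensional K (U.restrictScalars K))
    have : FiniteDimensional K (V ⧸ U) :=
      Module.Finite.of_surjective (U.mkQ.restrictScalars K) U.mkQ_surjective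
    have h1 : Module.finrank K D * m ∣ Module.finrank K U :=
      ih fun x hx u => Subtype.ext (hU u u.2 x hx)
    have h2 : Module.finrank K D * m ∣ Module.finrank K (V ⧸ U) := by
      refine finrank_dvd_of_smul_eq_zero e o fun x hx v => ?_
      obtain ⟨v, rfl⟩ := U.mkQ_surjective v
      rw [← map_smul]
      exact (Submodule.Quotient.mk_eq_zero U).2 (Submodule.subset_span ⟨x, hx, v, rfl⟩)
    have h3 : Module.finrank K (V ⧸ U) + Module.finrank K U = Module.finrank K V := by
      rw [← (U.restrictScalars K).finrank_quotient_add_finrank,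
        (Submodule.Quotient.restrictScalarsEquiv K U).finrank_eq]
      rfl
    rw [← h3]
    exact dvd_add h2 h1

end

/-- The preimage of the matrices whose row `o` vanishes. -/
theorem exists_rightIdeal_finrank_eq {K D : Type*} {A : Type u} [Field K] [Ring A] [Algebra K A]
    [DivisionRing D] [Algebra K D] [FiniteDimensional K D] {m : ℕ} {I : Ideal A} [I.IsTwoSided]
    (e : (A ⧸ I) ≃ₐ[K] Matrix (Fin m) (Fin m) D) (o : Fin m) :
    ∃ M : RightIdeal A, I.toRightIdeal ≤ M ∧ FiniteDimensional K (A ⧸ M) ∧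
      Module.finrank K (A ⧸ M) = Module.finrank K D * m := by
  let f : A →ₗ[K] (Fin m → D) :=
    { toFun := fun a => e (Ideal.Quotient.mk I a) o
      map_add' := fun a b => by simp only [map_add]; rfl
      map_smul' := fun r a => by
        have : Ideal.Quotient.mk I (r • a) = r • Ideal.Quotient.mk I a := rfl
        rw [this, map_smul]; rfl }
  have hf : Function.Surjective f := fun v => by
    obtain ⟨a, ha⟩ := Ideal.Quotient.mk_surjective (e.symm (Matrix.of fun _ => v))
    refine ⟨a, ?_⟩
    change e (Ideal.Quotient.mk I a) o = v
    rw [ha, e.apply_symm_apply]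
    rfl
  let M : RightIdeal A :=
    { carrier := LinearMap.ker f
      add_mem' := (LinearMap.ker f).add_mem
      zero_mem' := (LinearMap.ker f).zero_mem
      smul_mem' := fun c x hx => by
        have hx' : e (Ideal.Quotient.mk I x) o = 0 := hx
        change e (Ideal.Quotient.mk I (x * c.unop)) o = 0
        rw [map_mul, map_mul]
        funext j
        simp [Matrix.mul_apply, hx'] }
  let g : (A ⧸ M) ≃ₗ[K] (Fin m → D) := (Submodule.Quotient.restrictScalarsEquiv K M).symm.trans
    (f.quotKerEquivOfSurjective hf)
  refine ⟨M, fun x hx => ?_, Module.Finite.equiv g.symm, ?_⟩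
  · change e (Ideal.Quotient.mk I x) o = 0
    rw [Ideal.Quotient.eq_zero_iff_mem.2 hx, map_zero]
    rfl
  · rw [g.finrank_eq, Module.finrank_pi_fintype]
    simp [mul_comm]

/-- The augmentation to `K` carries inverse pairs of matrices to inverse pairs over a field. -/
instance FreeAlgebra.invariantBasisNumber {K X : Type*} [Field K] :
    InvariantBasisNumber (FreeAlgebra K X) := by
  let ε : FreeAlgebra K X →+* K := (FreeAlgebra.algebraMapInv : FreeAlgebra K X →ₐ[K] K)
  refine invariantBasisNumber_iff_matrix.2 fun p q M N h h' => ?_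
  have h1 : M.map ε * N.map ε = 1 := by
    rw [← Matrix.map_mul, h, Matrix.map_one ε (map_zero ε) (map_one ε)]
  have h2 : N.map ε * M.map ε = 1 := by
    rw [← Matrix.map_mul, h', Matrix.map_one ε (map_zero ε) (map_one ε)]
  simpa using Matrix.square_of_invertible _ _ h1 h2

/-! ### Isomorphisms `Q ≅ Q ^ j` as mutually inverse rows and columns. -/

section

variable {Q : Type u} [Ring Q]

theorem FreeRightModulesIso.exists_inverse {j : ℕ} (h : FreeRightModulesIso Q 1 j) :
    ∃ u v : Fin j → Q, ∑ i, v i * u i = 1 ∧ ∀ i k, u i * v k = if i = k then 1 else 0 := by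
  obtain ⟨f⟩ := h
  have hf : ∀ w i, f w i = f (fun _ => 1) i * w 0 := fun w i => by
    have h1 : w = op (w 0) • (fun _ => 1 : Fin 1 → Q) := by
      funext t
      simp [Subsingleton.elim t 0]
    conv_lhs => rw [h1, map_smul]
    rfl
  refine ⟨fun i => f (fun _ => 1) i, fun i => f.symm (Pi.single i 1) 0, ?_, fun i k => ?_⟩
  · have h1 : (∑ i, op (f (fun _ => 1) i) • Pi.single i (1 : Q)) = f (fun _ => 1) := by
      funext t
      simp [Finset.sum_apply, Pi.single_apply]
    have h2 := congrFun (congrArg f.symm h1) 0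
    rw [f.symm_apply_apply, map_sum, Finset.sum_apply] at h2
    refine Eq.trans ?_ h2
    exact Finset.sum_congr rfl fun i _ => by rw [map_smul]; rfl
  · rw [← hf, f.apply_symm_apply, Pi.single_apply]

theorem freeRightModulesIso_of_inverse {j : ℕ} {u v : Fin j → Q} (h : ∑ i, v i * u i = 1)
    (h' : ∀ i k, u i * v k = if i = k then 1 else 0) : FreeRightModulesIso Q 1 j := by
  refine ⟨{ toFun := fun w i => u i * w 0
            map_add' := fun x y => by funext i; simp [mul_add]
            map_smul' := fun c x => by funext i; simp [mul_assoc]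
            invFun := fun y _ => ∑ i, v i * y i
            left_inv := fun w => ?_
            right_inv := fun y => ?_ }⟩
  · funext t
    rw [Subsingleton.elim t 0]
    simp only [← mul_assoc, ← Finset.sum_mul, h, one_mul]
  · funext i
    simp [Finset.mul_sum, ← mul_assoc, h']

end

/-! ### The module type. -/

namespace FreeAlgebra

variable {K : Type u} [Field K] {n : ℕ} {I : Ideal (FreeAlgebra K (Fin n))} [I.IsTwoSided]
  (hn : 1 ≤ n) (hI : FiniteDimensional K (FreeAlgebra K (Fin n) ⧸ I))
  {Q : Type u} [Ring Q] {φ : FreeAlgebra K (Fin n) →+* Q}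

theorem exists_pow_mul_mem_range (hφ : (adicTopology hn hI).IsQuotientMap φ) {j : ℕ}
    (u : Fin j → Q) : ∃ k : ℕ, ∀ i, ∀ x ∈ I ^ k, ∃ a, u i * φ x = φ a := by
  choose J hJ hu using fun i => hφ.exists_mul_mem_range (u i)
  choose k hk using hJ
  exact ⟨Finset.univ.sup k, fun i x hx => hu i x
    (hk i (Ideal.pow_le_pow_right (Finset.le_sup (Finset.mem_univ i)) hx))⟩

variable {D : Type*} [DivisionRing D] [Algebra K D] [FiniteDimensional K D] {m : ℕ}
  (e : (FreeAlgebra K (Fin n) ⧸ I) ≃ₐ[K] Matrix (Fin m) (Fin m) D) (o : Fin m)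
include e o

theorem freeRightModulesIso_one (hφ : (adicTopology hn hI).IsQuotientMap φ) :
    FreeRightModulesIso Q 1 (Module.finrank K D * m * (n - 1) + 1) := by
  obtain ⟨M, hIM, hfin, hM⟩ := exists_rightIdeal_finrank_eq e o
  obtain ⟨b⟩ := exists_basis_rightIdeal hn M
  rw [hM] at b
  have hMF : M ∈ (adicTopology hn hI).opens := ⟨1, fun x hx => hIM (by rwa [Submodule.pow_one] at hx)⟩
  obtain ⟨g, hg, hg'⟩ := hφ.exists_dual_basis hMF b
  exact freeRightModulesIso_of_inverse hg hg'

theorem le_of_freeRightModulesIso_one (hφ : (adicTopology hn hI).IsQuotientMap φ) {j : ℕ}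
    (hj : 1 < j) (h : FreeRightModulesIso Q 1 j) :
    Module.finrank K D * m * (n - 1) + 1 ≤ j := by
  obtain ⟨u, v, hvu, huv⟩ := h.exists_inverse
  obtain ⟨k, hk⟩ := exists_pow_mul_mem_range hn hI hφ u
  obtain ⟨k', hk'⟩ := exists_pow_mul_mem_range hn hI hφ v
  choose a ha using (show ∀ i, ∀ x ∈ (I ^ k).toRightIdeal, ∃ a, u i * φ x = φ a from hk)
  have hinj := hφ.injective
  -- Multiplication by the column `u`; it is injective because the row `v` is a left inverse.
  let f : (I ^ k).toRightIdeal →ₗ[(FreeAlgebra K (Fin n))ᵐᵒᵖ] (Fin j → FreeAlgebra K (Fin n)) :=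
    { toFun := fun x i => a i x.1 x.2
      map_add' := fun x y => by
        funext i
        apply hinj
        rw [Pi.add_apply, map_add, ← ha, ← ha, ← ha, ← mul_add, ← map_add]
        rfl
      map_smul' := fun c x => by
        funext i
        apply hinj
        refine (ha i _ (c • x).2).symm.trans ?_
        change u i * φ (x.1 * c.unop) = φ (a i x.1 x.2 * c.unop)
        rw [map_mul, map_mul, ← ha, mul_assoc] }
  have hf : ∀ x i, φ (f x i) = u i * φ x := fun x i => (ha i x.1 x.2).symm
  have hfinj : Function.Injective f := by
    refine (injective_iff_map_eq_zero f).2 fun x hx => Subtype.ext (hinj ?_)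
    have h1 : ∑ i, v i * (u i * φ x) = φ x := by
      simp only [← mul_assoc, ← Finset.sum_mul, hvu, one_mul]
    rw [← h1]
    simp [← hf, hx]
  let N := LinearMap.range f
  have hN1 : ∀ i, ∀ y ∈ I ^ (k' + k), Pi.single i y ∈ N := by
    intro i
    refine RightIdeal.pow_add_subset
      (J := N.comap (LinearMap.single (FreeAlgebra K (Fin n))ᵐᵒᵖ
        (fun _ => FreeAlgebra K (Fin n)) i)) fun p hp r hr => ?_
    -- With `v i * φ p = φ c`, multiplying `c * r ∈ I ^ k` by `u` returns `p * r` in place `i` and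
    -- zero elsewhere.
    obtain ⟨c, hc⟩ := hk' i p hp
    refine ⟨⟨c * r, (I ^ k).mul_mem_left c hr⟩, funext fun t => hinj ?_⟩
    rw [hf]
    change u t * φ (c * r) = φ (Pi.single (M := fun _ => FreeAlgebra K (Fin n)) i (p * r) t)
    rw [map_mul, ← hc, mul_assoc, ← map_mul, ← mul_assoc, huv, Pi.single_apply]
    split_ifs <;> simp
  have hN : ∀ y : Fin j → FreeAlgebra K (Fin n), (∀ i, y i ∈ I ^ (k' + k)) → y ∈ N := by
    intro y hy
    rw [← Finset.univ_sum_single y]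
    exact N.sum_mem fun i _ => hN1 i _ (hy i)
  have hfin := finiteDimensional_quotient_pow hn hI k
  have hfinN : FiniteDimensional K ((Fin j → FreeAlgebra K (Fin n)) ⧸ N) := by
    obtain ⟨W, hW, h⟩ := (Submodule.finiteDimensional_quotient_iff _).1
      (finiteDimensional_quotient_pow hn hI (k' + k))
    choose w hw hw' using h
    refine (Submodule.finiteDimensional_quotient_iff _).2
      ⟨⨆ i, W.map (LinearMap.single K _ i), Submodule.fg_iSup _ fun i => hW.map _,
        fun x => ⟨fun i => w (x i), ?_, hN _ fun i => hw' (x i)⟩⟩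
    rw [← Finset.univ_sum_single fun i => w (x i)]
    exact Submodule.sum_mem _ fun i _ => Submodule.mem_iSup_of_mem i ⟨_, hw _, rfl⟩
  obtain ⟨b⟩ := exists_basis_rightIdeal hn (I ^ k).toRightIdeal
  obtain ⟨c⟩ := exists_basis_of_finiteDimensional_quotient N hn
    ((Pi.basisFun (FreeAlgebra K (Fin n))ᵐᵒᵖ (Fin j)).map
      (LinearEquiv.piCongrRight fun _ => MulOpposite.unopLinearEquiv _))
  -- `N` and `I ^ k` are isomorphic, so invariant basis number equates the two Schreier–Lewin ranks.
  have hrank := (c.map (LinearEquiv.ofInjective f hfinj).symm).indexEquiv b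
  obtain ⟨s, hs⟩ := finrank_dvd_of_pow_smul_eq_zero e o k
    (V := FreeAlgebra K (Fin n) ⧸ (I ^ k).toRightIdeal) fun x hx v => by
      obtain ⟨v, rfl⟩ := Submodule.mkQ_surjective _ v
      rw [← map_smul]
      exact (Submodule.Quotient.mk_eq_zero _).2 ((I ^ k).mul_mem_left v hx)
  obtain ⟨t, ht⟩ := finrank_dvd_of_pow_smul_eq_zero e o (k' + k)
    (V := (Fin j → FreeAlgebra K (Fin n)) ⧸ N) fun x hx v => by
      obtain ⟨v, rfl⟩ := Submodule.mkQ_surjective _ v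
      rw [← map_smul]
      exact (Submodule.Quotient.mk_eq_zero _).2 (hN _ fun i => (I ^ (k' + k)).mul_mem_left (v i) hx)
  have hcard := Fintype.card_congr hrank
  simp only [Fintype.card_fin, hs, ht] at hcard
  generalize Module.finrank K D * m = q at hcard ⊢
  -- From `q * t * (n - 1) + j = q * s * (n - 1) + 1` and `j > 1`. The gap `s - t ≥ 1` then yields
  -- the bound.
  have hts : t < s := by
    by_contra! hst
    have := Nat.mul_le_mul_right (n - 1) (Nat.mul_le_mul_left q hst)
    omega
  have := Nat.mul_le_mul_right (n - 1) (Nat.mul_le_mul_left q (Nat.succ_le_of_lt hts))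
  rw [Nat.mul_succ, Nat.add_mul] at this
  omega

end FreeAlgebra

end

theorem theorem3p10 {K : Type u} [Field K] (n : ℕ) (hn : 2 ≤ n)
    (I : TwoSidedIdeal (FreeAlgebra K (Fin n))) (hI : IsCoatom I)
    {D : Type*} [DivisionRing D] [Algebra K D] [FiniteDimensional K D]
    (l m : ℕ) (hl : Module.finrank K D = l)
    (e : (FreeAlgebra K (Fin n) ⧸ I.asIdeal) ≃ₐ[K] Matrix (Fin m) (Fin m) D) :
    ∃ F : GabrielTopology (FreeAlgebra K (Fin n)),
      (∀ J : RightIdeal (FreeAlgebra K (Fin n)),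
        J ∈ F.opens ↔ ∃ k : ℕ, ((I.asIdeal ^ k : Ideal _) : Set (FreeAlgebra K (Fin n))) ⊆ J) ∧
      F.IsPerfect ∧
      HasModuleType F.RightQuotients 1 (l * m * (n - 1) + 1) := by
  subst hl
  have hn1 : 1 ≤ n := by omega
  have hfin : FiniteDimensional K (FreeAlgebra K (Fin n) ⧸ I.asIdeal) :=
    Module.Finite.equiv e.symm.toLinearEquiv
  -- For `m = 0` the matrix ring is zero, contradicting that `I` is proper.
  have hm : 0 < m := by
    rw [Nat.pos_iff_ne_zero]
    rintro rfl
    refine hI.1 (eq_top_iff.2 fun x _ => TwoSidedIdeal.mem_asIdeal.1 ?_)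
    rw [← Ideal.Quotient.eq_zero_iff_mem]
    exact e.injective (Subsingleton.elim _ _)
  have hφ := GabrielTopology.isQuotientMap_toRightQuotients
    (FreeAlgebra.torsion_adicTopology hn1 hfin)
  have hiso := FreeAlgebra.freeRightModulesIso_one hn1 hfin e ⟨0, hm⟩ hφ
  have hlt : 1 < Module.finrank K D * m * (n - 1) + 1 :=
    Nat.lt_add_of_pos_left (Nat.mul_pos (Nat.mul_pos Module.finrank_pos hm) (by omega))
  exact ⟨FreeAlgebra.adicTopology hn1 hfin, fun _ => Iff.rfl,
    FreeAlgebra.isPerfect_adicTopology hn1 hfin, hφ.injective.nontrivial,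
    ⟨⟨le_rfl, _, hlt, hiso⟩, fun _ h => h.1⟩, ⟨hlt, hiso⟩, fun _ h =>
      FreeAlgebra.le_of_freeRightModulesIso_one hn1 hfin e ⟨0, hm⟩ hφ h.1 h.2⟩
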